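/- Let $k$ be a field, let $Q=(Q_0,Q_1;s,t)$ be a finite quiver (finitely many vertices and arrows), and let $kQ$ be its path algebra, where paths are composed from right to left: $pq$ denotes first $q$, then $p$, and it is defined when $s(p)=t(q)$; otherwise the product of $p$ and $q$ in $kQ$ is zero. Let $J$ be the two-sided ideal of $kQ$ generated by the arrows, and let $I$ be a monomial ideal, that is, a two-sided ideal which is generated by some set of paths of length at least two and satisfies $J^d\subseteq I\subseteq J^2$ for some $d\ge 2$. Let $A=kQ/I$ be the corresponding monomial algebra. A path $p$ is a *nonzero path in $A$* if $p\notin I$; one identifies $p$ with its image in $A$ and writes $Ap$ for the left ideal of $A$ generated by $p$. A pair $(p,q)$ of nonzero paths in $A$, both of length at least one, is *perfect* if 1. $s(p)=t(q)$ and $pq=0$ in $A$; 2. whenever $q'$ is a nonzero path with $t(q')=s(p)$ and $pq'=0$ in $A$, one has $q'=qq''$ for some path $q''$; 3. whenever $p'$ is a nonzero path with $s(p')=t(q)$ and $p'q=0$ in $A$, one has $p'=p''p$ for some path $p''$. A nonzero path $p$ in $A$ is *perfect* if there are $n\ge 1$ and nonzero paths $p=p_1,p_2,\dots,p_n,p_{n+1}=p$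 such that $(p_i,p_{i+1})$ is a perfect pair for all $1\le i\le n$. A finite-dimensional left $A$-module $M$ is *Gorenstein-projective* if there is an acyclic complex $P^\bullet=(P^i,d^i)_{i\in\mathbb Z}$ of finite-dimensional projective left $A$-modules such that the complex $\operatorname{Hom}_A(P^\bullet,A)$ is also acyclic and $M\cong\operatorname{Ker}d^i$ for some $i$. **Theorem 4.1.** The assignment $p\mapsto Ap$ induces a bijection from the set of perfect paths in $A$ to the set of isomorphism classes of indecomposable non-projective Gorenstein-projective finite-dimensional left $A$-modules. -/

import Mathlib

namespace MonomialGorenstein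

open CategoryTheory

universe u v w

/-- A path in the quiver `Q`, bundled with its starting vertex and its terminating vertex.
The trivial paths are included. -/
@[ext]
structure QPath (Q : Type v) [Quiver.{w} Q] where
  /-- the starting vertex `s(p)` -/
  source : Q
  /-- the terminating vertex `t(p)` -/
  target : Q
  /-- the underlying path -/
  path : Quiver.Path source target

namespace QPath

variable {Q : Type v} [Quiver.{w} Q]

/-- The trivial path `e_i` at the vertex `i`. -/
def triv (i : Q) : QPath Q := ⟨i, i, Quiver.Path.nil⟩

/-- The path of length one given by an arrow. -/
def ofArrow {a b : Q} (α : a ⟶ b) : QPath Q := ⟨a, b, α.toPath⟩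

/-- The length of a path, i.e. the number of its arrows. -/
def length (p : QPath Q) : ℕ := p.path.length

/-- The concatenation `pq` of two paths with `s(p) = t(q)`. Paths are written from right to left:
`pq` is first `q` and then `p`. -/
def comp (p q : QPath Q) (h : p.source = q.target) : QPath Q :=
  ⟨q.source, p.target, q.path.comp (p.path.cast h rfl)⟩

@[simp] theorem comp_source (p q : QPath Q) (h : p.source = q.target) :
    (p.comp q h).source = q.source := rfl

@[simp] theorem comp_target (p q : QPath Q) (h : p.source = q.target) :
    (p.comp q h).target = p.target := rfl

theorem comp_assoc (p q r : QPath Q) (h₁ : p.source = q.target) (h₂ : q.source = r.target) :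
    (p.comp q h₁).comp r h₂ = p.comp (q.comp r h₂) h₁ := by
  obtain ⟨a, b, p⟩ := p
  obtain ⟨c, d, q⟩ := q
  obtain ⟨e, f, r⟩ := r
  dsimp only at h₁ h₂
  subst h₁
  subst h₂
  simp [comp]

theorem triv_comp (i : Q) (p : QPath Q) (h : i = p.target) : (triv i).comp p h = p := by
  obtain ⟨a, b, p⟩ := p
  dsimp only at h
  subst h
  simp [comp, triv]

theorem comp_triv (i : Q) (p : QPath Q) (h : p.source = i) : p.comp (triv i) h = p := by
  obtain ⟨a, b, p⟩ := p
  dsimp only at h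
  subst h
  simp [comp, triv]

end QPath

/-- The path algebra `kQ`: the `k`-vector space with basis the paths of `Q`. Its multiplication is
defined below. -/
def PathAlgebra (k : Type u) (Q : Type v) [Field k] [Quiver.{w} Q] : Type (max u v w) :=
  QPath Q →₀ k

namespace PathAlgebra

section

variable (k : Type u) (Q : Type v) [Field k] [Quiver.{w} Q]

noncomputable instance : AddCommGroup (PathAlgebra k Q) :=
  inferInstanceAs (AddCommGroup (QPath Q →₀ k))

noncomputable instance : Module k (PathAlgebra k Q) :=
  inferInstanceAs (Module k (QPath Q →₀ k))

variable {Q}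

/-- The basis element of the path algebra given by a path. -/
noncomputable def ofPath (p : QPath Q) : PathAlgebra k Q :=
  (Finsupp.single p 1 : QPath Q →₀ k)

variable (Q)

/-- The paths form a basis of the path algebra. -/
noncomputable def basis : Module.Basis (QPath Q) k (PathAlgebra k Q) :=
  ⟨LinearEquiv.refl k (QPath Q →₀ k)⟩

theorem basis_apply (p : QPath Q) : basis k Q p = ofPath k p := rfl

variable {Q}

open Classical in
/-- The product of two basis elements: the concatenation `pq` if `s(p) = t(q)`, and zero
otherwise. -/
noncomputable def mulPath (p q : QPath Q) : PathAlgebra k Q :=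
  if h : p.source = q.target then ofPath k (p.comp q h) else 0

variable (Q)

/-- The multiplication of the path algebra, as the bilinear extension of `mulPath`. -/
noncomputable def mulBilin : PathAlgebra k Q →ₗ[k] PathAlgebra k Q →ₗ[k] PathAlgebra k Q :=
  (basis k Q).constr k fun p => (basis k Q).constr k fun q => mulPath k p q

noncomputable instance : Mul (PathAlgebra k Q) := ⟨fun x y => mulBilin k Q x y⟩

theorem mul_eq (x y : PathAlgebra k Q) : x * y = mulBilin k Q x y := rfl

variable {Q}

theorem ofPath_mul_ofPath (p q : QPath Q) : ofPath k p * ofPath k q = mulPath k p q := by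
  rw [mul_eq, ← basis_apply, ← basis_apply, mulBilin, Module.Basis.constr_basis,
    Module.Basis.constr_basis]

theorem ofPath_mul_ofPath_of_eq (p q : QPath Q) (h : p.source = q.target) :
    ofPath k p * ofPath k q = ofPath k (p.comp q h) := by
  rw [ofPath_mul_ofPath, mulPath, dif_pos h]

theorem ofPath_mul_ofPath_of_ne (p q : QPath Q) (h : p.source ≠ q.target) :
    ofPath k p * ofPath k q = 0 := by
  rw [ofPath_mul_ofPath, mulPath, dif_neg h]

@[elab_as_elim]
theorem induction_on {P : PathAlgebra k Q → Prop} (x : PathAlgebra k Q) (zero : P 0)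
    (add : ∀ y z, P y → P z → P (y + z)) (single : ∀ (c : k) (p : QPath Q), P (c • ofPath k p)) :
    P x := by
  refine Finsupp.induction_linear (motive := P) x zero add fun p c => ?_
  have h : (Finsupp.single p c : QPath Q →₀ k) = c • (Finsupp.single p 1 : QPath Q →₀ k) := by
    simp
  rw [h]
  exact single c p

variable (Q)

noncomputable instance : NonUnitalNonAssocRing (PathAlgebra k Q) where
  __ := (inferInstance : AddCommGroup (PathAlgebra k Q))
  left_distrib x y z := by simp only [mul_eq, map_add]
  right_distrib x y z := by simp only [mul_eq, map_add, LinearMap.add_apply]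
  zero_mul x := by simp only [mul_eq, map_zero, LinearMap.zero_apply]
  mul_zero x := by simp only [mul_eq, map_zero]

theorem smul_mul (c : k) (x y : PathAlgebra k Q) : c • x * y = c • (x * y) := by
  simp only [mul_eq, map_smul, LinearMap.smul_apply]

theorem mul_smul' (c : k) (x y : PathAlgebra k Q) : x * c • y = c • (x * y) := by
  simp only [mul_eq, map_smul]

theorem mul_assoc' (x y z : PathAlgebra k Q) : x * y * z = x * (y * z) := by
  induction x using induction_on with
  | zero => simp only [zero_mul]
  | add x x' hx hx' => simp only [add_mul, hx, hx']
  | single a p =>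
  induction y using induction_on with
  | zero => simp only [zero_mul, mul_zero]
  | add y y' hy hy' => simp only [add_mul, mul_add, hy, hy']
  | single b q =>
  induction z using induction_on with
  | zero => simp only [mul_zero]
  | add z z' hz hz' => simp only [mul_add, hz, hz']
  | single c r =>
  simp only [smul_mul, mul_smul']
  congr 3
  by_cases h₁ : p.source = q.target
  · rw [ofPath_mul_ofPath_of_eq k p q h₁]
    by_cases h₂ : q.source = r.target
    · rw [ofPath_mul_ofPath_of_eq k q r h₂, ofPath_mul_ofPath_of_eq k (p.comp q h₁) r h₂,
        ofPath_mul_ofPath_of_eq k p (q.comp r h₂) h₁, QPath.comp_assoc]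
    · rw [ofPath_mul_ofPath_of_ne k q r h₂, ofPath_mul_ofPath_of_ne k (p.comp q h₁) r h₂, mul_zero]
  · rw [ofPath_mul_ofPath_of_ne k p q h₁, zero_mul]
    by_cases h₂ : q.source = r.target
    · rw [ofPath_mul_ofPath_of_eq k q r h₂, ofPath_mul_ofPath_of_ne k p (q.comp r h₂) h₁]
    · rw [ofPath_mul_ofPath_of_ne k q r h₂, mul_zero]

variable [Fintype Q]

noncomputable instance : One (PathAlgebra k Q) := ⟨∑ i : Q, ofPath k (QPath.triv i)⟩

theorem one_eq : (1 : PathAlgebra k Q) = ∑ i : Q, ofPath k (QPath.triv i) := rfl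

theorem one_mul' (x : PathAlgebra k Q) : 1 * x = x := by
  induction x using induction_on with
  | zero => simp only [mul_zero]
  | add x y hx hy => simp only [mul_add, hx, hy]
  | single c p =>
    rw [mul_smul', one_eq, Finset.sum_mul, Finset.sum_eq_single p.target]
    · exact congrArg (c • ·) ((ofPath_mul_ofPath_of_eq k (QPath.triv p.target) p rfl).trans
        (congrArg (ofPath k) (QPath.triv_comp p.target p rfl)))
    · intro i _ hi
      exact ofPath_mul_ofPath_of_ne k (QPath.triv i) p hi
    · intro h
      exact absurd (Finset.mem_univ _) h

theorem mul_one' (x : PathAlgebra k Q) : x * 1 = x := by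
  induction x using induction_on with
  | zero => simp only [zero_mul]
  | add x y hx hy => simp only [add_mul, hx, hy]
  | single c p =>
    rw [smul_mul, one_eq, Finset.mul_sum, Finset.sum_eq_single p.source]
    · exact congrArg (c • ·) ((ofPath_mul_ofPath_of_eq k p (QPath.triv p.source) rfl).trans
        (congrArg (ofPath k) (QPath.comp_triv p.source p rfl)))
    · intro i _ hi
      exact ofPath_mul_ofPath_of_ne k p (QPath.triv i) hi.symm
    · intro h
      exact absurd (Finset.mem_univ _) h

noncomputable instance : Ring (PathAlgebra k Q) where
  __ := (inferInstance : NonUnitalNonAssocRing (PathAlgebra k Q))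
  mul_assoc := mul_assoc' k Q
  one_mul := one_mul' k Q
  mul_one := mul_one' k Q

noncomputable instance : Algebra k (PathAlgebra k Q) :=
  Algebra.ofModule (smul_mul k Q) (mul_smul' k Q)

end

end PathAlgebra

section Monomial

variable (k : Type u) (Q : Type v) [Field k] [Quiver.{w} Q] [Fintype Q]

/-- The two-sided ideal `J` of `kQ` generated by the arrows. -/
noncomputable def arrowIdeal : Ideal (PathAlgebra k Q) :=
  (TwoSidedIdeal.span
    {x | ∃ (a b : Q) (α : a ⟶ b), x = PathAlgebra.ofPath k (QPath.ofArrow α)}).asIdeal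

variable {k Q}

/-- The ideal `I` of `kQ` is admissible: `J ^ d ⊆ I ⊆ J ^ 2` for some `d ≥ 2`. -/
def IsAdmissible (I : Ideal (PathAlgebra k Q)) : Prop :=
  ∃ d : ℕ, 2 ≤ d ∧ arrowIdeal k Q ^ d ≤ I ∧ I ≤ arrowIdeal k Q ^ 2

/-- The ideal `I` of `kQ` is monomial: it is admissible and it is generated, as a two-sided ideal,
by a set of paths of length at least two. -/
def IsMonomial (I : Ideal (PathAlgebra k Q)) : Prop :=
  IsAdmissible I ∧ ∃ S : Set (QPath Q), (∀ p ∈ S, 2 ≤ p.length) ∧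
    I = (TwoSidedIdeal.span (PathAlgebra.ofPath k '' S)).asIdeal

variable (I : Ideal (PathAlgebra k Q)) [I.IsTwoSided]

/-- The canonical image of a path in the algebra `A = kQ/I`. -/
noncomputable def pathIn (p : QPath Q) : PathAlgebra k Q ⧸ I :=
  Ideal.Quotient.mk I (PathAlgebra.ofPath k p)

/-- The path `p` is a nonzero path in `A = kQ/I`, that is, it does not lie in `I`. -/
def IsNonzeroPath (p : QPath Q) : Prop := pathIn I p ≠ 0

/-- The left ideal `Ap` of `A = kQ/I` generated by a path `p`. -/
noncomputable def leftIdeal (p : QPath Q) : Ideal (PathAlgebra k Q ⧸ I) :=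
  Ideal.span {pathIn I p}

/-- A perfect pair `(p, q)` of nonzero paths in `A = kQ/I`. -/
structure IsPerfectPair (p q : QPath Q) : Prop where
  nonzero_left : IsNonzeroPath I p
  nonzero_right : IsNonzeroPath I q
  nontrivial_left : 1 ≤ p.length
  nontrivial_right : 1 ≤ q.length
  source_eq : p.source = q.target
  mul_eq_zero : pathIn I p * pathIn I q = 0
  /-- If `pq' = 0` for a nonzero path `q'` with `t(q') = s(p)`, then `q' = qq''` for some path
  `q''`. -/
  right_unique : ∀ q' : QPath Q, IsNonzeroPath I q' → q'.target = p.source →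
    pathIn I p * pathIn I q' = 0 → ∃ (q'' : QPath Q) (h : q.source = q''.target), q' = q.comp q'' h
  /-- If `p'q = 0` for a nonzero path `p'` with `s(p') = t(q)`, then `p' = p''p` for some path
  `p''`. -/
  left_unique : ∀ p' : QPath Q, IsNonzeroPath I p' → p'.source = q.target →
    pathIn I p' * pathIn I q = 0 → ∃ (p'' : QPath Q) (h : p''.source = p.target), p' = p''.comp p h

/-- A perfect path `p` in `A = kQ/I`: a nonzero path for which there are `n ≥ 1` and a sequence
`p = p₁, p₂, …, pₙ, pₙ₊₁ = p` of nonzero paths such that all the `(pᵢ, pᵢ₊₁)`, `1 ≤ i ≤ n`, are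
perfect pairs. -/
def IsPerfectPath (p : QPath Q) : Prop :=
  IsNonzeroPath I p ∧ ∃ (n : ℕ) (s : ℕ → QPath Q), 1 ≤ n ∧ s 1 = p ∧ s (n + 1) = p ∧
    ∀ i, 1 ≤ i → i ≤ n → IsPerfectPair I (s i) (s (i + 1))

end Monomial

section Modules

/-- A module is indecomposable if it is nonzero and is not the direct sum of two nonzero
submodules. -/
def IsIndecomposable (R : Type u) [Ring R] (M : Type v) [AddCommGroup M] [Module R M] : Prop :=
  Nontrivial M ∧ ∀ N₁ N₂ : Submodule R M, IsCompl N₁ N₂ → N₁ = ⊥ ∨ N₂ = ⊥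

/-- A module `M` is Gorenstein-projective if there is an acyclic complex `(P, d)` of finitely
generated projective left `R`-modules such that the complex `Hom_R(P, R)` is still acyclic and such
that `M` is isomorphic to the module of cocycles `Ker dⁱ` for some `i`. -/
def IsGorensteinProjective (R : Type u) [Ring R] (M : Type v) [AddCommGroup M] [Module R M] :
    Prop :=
  ∃ (P : ℤ → ModuleCat.{u} R) (d : ∀ i : ℤ, P i →ₗ[R] P (i + 1)),
    (∀ i, Module.Finite R (P i) ∧ Module.Projective R (P i)) ∧
    (∀ i, Function.Exact (d i) (d (i + 1))) ∧
    (∀ i, Function.Exact (fun f : P (i + 1 + 1) →ₗ[R] R => f ∘ₗ d (i + 1))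
      (fun f : P (i + 1) →ₗ[R] R => f ∘ₗ d i)) ∧
    ∃ i, Nonempty (M ≃ₗ[R] LinearMap.ker (d i))

/-- The isomorphism classes of left `R`-modules. -/
abbrev Isoclass (R : Type u) [Ring R] : Type (u + 1) :=
  Quotient (isIsomorphicSetoid (ModuleCat.{u} R))

/-- The isomorphism class of a left `R`-module. -/
abbrev isoclass (R : Type u) [Ring R] (M : Type u) [AddCommGroup M] [Module R M] : Isoclass R :=
  Quotient.mk (isIsomorphicSetoid (ModuleCat.{u} R)) (ModuleCat.of R M)

/-- The set of isomorphism classes of indecomposable non-projective Gorenstein-projective finitely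
generated left `R`-modules. (Over a finite-dimensional algebra, finitely generated modules are the
same as finite-dimensional modules.) -/
def indecGProj (R : Type u) [Ring R] : Set (Isoclass R) :=
  {c | ∃ M : ModuleCat.{u} R, isoclass R M = c ∧ Module.Finite R M ∧ IsIndecomposable R M ∧
    ¬ Module.Projective R M ∧ IsGorensteinProjective R M}

end Modules

end MonomialGorenstein

/-!
Since `I` is monomial, the nonzero paths form a basis of `A = kQ/I`, and every element has a normal
form. The basic operation is to cut an element down to the paths beginning (or ending) with a given
path `p`. Cutting down to `pA` commutes with right multiplication on those elements in which all
paths are at least as long as `p`, and similarly for `Ap` and left multiplication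
(`part_rightMultiples_mul`, `part_leftMultiples_mul`). In each application `p` is chosen as a
shortest path in a suitable set.

*Perfect paths give modules of the required kind.* A cyclic sequence of perfect pairs `(pᵢ, pᵢ₊₁)`
yields a periodic complex of left ideals `Ae` with right multiplication by `pᵢ` as differentials.
The two uniqueness conditions say exactly that this complex and its dual are exact, and `Ap` is a
module of cocycles. The module `Ap` is local because the radical of `A` is nilpotent, and it is not
projective because `Ae` is indecomposable and `Ap` has a nonzero first syzygy. An isomorphism
`Ap ≅ Aq` maps `p` to an element in which `q` occurs, so that the paths generating the left
annihilators of `p` and `q` agree, and they determine `p` and `q`.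

*Every module of the required kind arises.* Let `M` be indecomposable and Gorenstein-projective.
It is torsionless and reflexive. Choose a shortest path `p` among all paths occurring in the values
`g(m)` of functionals `g` on `M`. Cutting a functional down to `Ap` gives a surjection `M → Ap`;
cutting the values `g(m)` down to `pA` gives a right-linear functional on the dual of `M`, hence by
reflexivity an element of `M`, which splits this surjection. So `M ≅ Ap`
(`IsGorensteinProjective.exists_equiv_leftIdeal`).

If `M` is not projective, then the syzygy of `Ap`, the left annihilator of `p` in `Ae`, is nonzero.
Let `q` be a shortest path in it. By total acyclicity, cutting down to `Aq` extends to a functional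
on `Ae`, which forces the syzygy to be `Aq` (`exists_isLeftAnnihilator`). Syzygies inherit the
properties used here, because direct summands up to projectives of modules of cocycles are stable
under syzygies (`IsTotallyAcyclic.extension_and_syzygy`). So one obtains an infinite sequence of
paths, each generating the left annihilator of the preceding one. Reflexivity of `Ap`, and then the
extension of functionals from `Aq` to `Ae`, show that consecutive members form perfect pairs. There
are only finitely many nonzero paths, and the second member of a perfect pair is determined by the
first one, so the sequence is periodic and `p` is perfect (`isPerfectPath_of_sequence`).
-/

namespace MonomialGorenstein

/-! ### Combinatorics of paths -/

namespace QPath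

variable {Q : Type*} [Quiver Q]

theorem length_comp (p q : QPath Q) (h : p.source = q.target) :
    (p.comp q h).length = p.length + q.length := by
  obtain ⟨a, b, p⟩ := p
  obtain ⟨c, d, q⟩ := q
  dsimp only at h
  subst h
  simp [comp, length, Nat.add_comm]

@[simp] theorem length_triv (i : Q) : (triv i).length = 0 := rfl

theorem eq_triv_of_length_eq_zero (p : QPath Q) (h : p.length = 0) : p = triv p.source := by
  obtain ⟨a, b, p⟩ := p
  obtain rfl := p.eq_of_length_zero h
  obtain rfl := p.eq_nil_of_length_zero h
  rfl

theorem comp_left_cancel {p w w' : QPath Q} {h : p.source = w.target} {h' : p.source = w'.target}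
    (e : p.comp w h = p.comp w' h') : w = w' := by
  obtain ⟨a, b, p⟩ := p
  obtain ⟨c, d, w⟩ := w
  obtain ⟨c', d', w'⟩ := w'
  dsimp only at h h'
  subst h
  subst h'
  simp only [comp, mk.injEq, Quiver.Path.cast_rfl_rfl, true_and] at e
  obtain ⟨rfl, e⟩ := e
  rw [heq_eq_eq, Quiver.Path.comp_inj_left] at e
  rw [e]

theorem comp_right_cancel {p w w' : QPath Q} {h : w.source = p.target} {h' : w'.source = p.target}
    (e : w.comp p h = w'.comp p h') : w = w' := by
  obtain ⟨a, b, p⟩ := p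
  obtain ⟨c, d, w⟩ := w
  obtain ⟨c', d', w'⟩ := w'
  dsimp only at h h'
  subst h
  subst h'
  simp only [comp, mk.injEq, Quiver.Path.cast_rfl_rfl, true_and] at e
  obtain ⟨rfl, e⟩ := e
  rw [heq_eq_eq, Quiver.Path.comp_inj_right] at e
  rw [e]

/-- If a path begins with `p` and with `w`, and `p` is at most as long as `w`, then `w` begins
with `p`. -/
theorem _root_.Quiver.Path.exists_eq_comp_of_comp_eq_comp {a b c : Q} (w : Quiver.Path a b)
    (r : Quiver.Path b c) : ∀ {d : Q} (p : Quiver.Path a d) (u : Quiver.Path d c),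
    w.comp r = p.comp u → p.length ≤ w.length → ∃ v : Quiver.Path d b, w = p.comp v := by
  induction r with
  | nil => exact fun p u h _ => ⟨u, h⟩
  | cons r α ih =>
    intro d p u h hl
    cases u with
    | nil =>
      have := congrArg Quiver.Path.length h
      simp at this
      omega
    | cons u β =>
      simp only [Quiver.Path.comp_cons] at h
      obtain rfl := Quiver.Path.obj_eq_of_cons_eq_cons h
      exact ih p u (eq_of_heq (Quiver.Path.heq_of_cons_eq_cons h)) hl

/-- The set of paths of the form `uq`. -/
def leftMultiples (q : QPath Q) : Set (QPath Q) :=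
  {v | ∃ (u : QPath Q) (h : u.source = q.target), v = u.comp q h}

/-- The set of paths of the form `pu`. -/
def rightMultiples (p : QPath Q) : Set (QPath Q) :=
  {v | ∃ (u : QPath Q) (h : p.source = u.target), v = p.comp u h}

theorem self_mem_leftMultiples (p : QPath Q) : p ∈ p.leftMultiples :=
  ⟨triv p.target, rfl, (triv_comp _ _ _).symm⟩

theorem self_mem_rightMultiples (p : QPath Q) : p ∈ p.rightMultiples :=
  ⟨triv p.source, rfl, (comp_triv _ _ _).symm⟩

theorem length_le_of_mem_leftMultiples {p q : QPath Q} (h : p ∈ q.leftMultiples) :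
    q.length ≤ p.length := by
  obtain ⟨u, hu, rfl⟩ := h
  rw [length_comp]
  omega

theorem length_le_of_mem_rightMultiples {p q : QPath Q} (h : p ∈ q.rightMultiples) :
    q.length ≤ p.length := by
  obtain ⟨u, hu, rfl⟩ := h
  rw [length_comp]
  omega

theorem source_eq_of_mem_leftMultiples {p q : QPath Q} (h : p ∈ q.leftMultiples) :
    p.source = q.source := by
  obtain ⟨u, hu, rfl⟩ := h
  rfl

theorem leftMultiples_antisymm {p q : QPath Q} (h : p ∈ q.leftMultiples)
    (h' : q ∈ p.leftMultiples) : p = q := by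
  obtain ⟨u, hu, rfl⟩ := h
  have := length_le_of_mem_leftMultiples h'
  rw [length_comp] at this
  obtain ⟨i, rfl⟩ : ∃ i, u = triv i := ⟨_, eq_triv_of_length_eq_zero u (by omega)⟩
  exact triv_comp _ _ _

theorem rightMultiples_antisymm {p q : QPath Q} (h : p ∈ q.rightMultiples)
    (h' : q ∈ p.rightMultiples) : p = q := by
  obtain ⟨u, hu, rfl⟩ := h
  have := length_le_of_mem_rightMultiples h'
  rw [length_comp] at this
  obtain ⟨i, rfl⟩ : ∃ i, u = triv i := ⟨_, eq_triv_of_length_eq_zero u (by omega)⟩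
  exact comp_triv _ _ _

theorem comp_mem_leftMultiples {w q : QPath Q} (r : QPath Q) (h : r.source = w.target)
    (hw : w ∈ q.leftMultiples) : r.comp w h ∈ q.leftMultiples := by
  obtain ⟨u, hu, rfl⟩ := hw
  exact ⟨r.comp u h, hu, (comp_assoc _ _ _ _ _).symm⟩

theorem comp_mem_rightMultiples {w p : QPath Q} (r : QPath Q) (h : w.source = r.target)
    (hw : w ∈ p.rightMultiples) : w.comp r h ∈ p.rightMultiples := by
  obtain ⟨u, hu, rfl⟩ := hw
  exact ⟨u.comp r h, hu, comp_assoc _ _ _ _ _⟩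

theorem mem_leftMultiples_of_comp_mem {r w q : QPath Q} {h : r.source = w.target}
    (hm : r.comp w h ∈ q.leftMultiples) (hl : q.length ≤ w.length) : w ∈ q.leftMultiples := by
  obtain ⟨u, hu, e⟩ := hm
  obtain ⟨a, b, r⟩ := r
  obtain ⟨c, d, w⟩ := w
  obtain ⟨c', d', q⟩ := q
  obtain ⟨a', b', u⟩ := u
  dsimp only at h hu
  subst h
  subst hu
  simp only [comp, mk.injEq, Quiver.Path.cast_rfl_rfl] at e
  obtain ⟨rfl, rfl, e⟩ := e
  obtain ⟨v, rfl⟩ := Quiver.Path.exists_eq_comp_of_comp_eq_comp w r q u (eq_of_heq e) hl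
  exact ⟨⟨_, _, v⟩, rfl, by simp [comp]⟩

theorem mem_rightMultiples_of_comp_mem {r w p : QPath Q} {h : w.source = r.target}
    (hm : w.comp r h ∈ p.rightMultiples) (hl : p.length ≤ w.length) :
    w ∈ p.rightMultiples := by
  obtain ⟨u, hu, e⟩ := hm
  have hlen := congrArg length e
  rw [length_comp, length_comp] at hlen
  obtain ⟨a, b, r⟩ := r
  obtain ⟨c, d, w⟩ := w
  obtain ⟨c', d', p⟩ := p
  obtain ⟨a', b', u⟩ := u
  dsimp only at h hu
  subst h
  subst hu
  simp only [comp, mk.injEq, Quiver.Path.cast_rfl_rfl] at e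
  obtain ⟨rfl, rfl, e⟩ := e
  have e' := eq_of_heq e
  -- the start `u` is at least as long as the start `r`
  obtain ⟨v, rfl⟩ := Quiver.Path.exists_eq_comp_of_comp_eq_comp u p r w e'.symm (by
    simp only [length] at hlen hl
    omega)
  rw [Quiver.Path.comp_assoc, Quiver.Path.comp_inj_right] at e'
  exact ⟨⟨_, _, v⟩, rfl, by simp [comp, e']⟩

theorem finite_length_eq [Finite Q] [∀ a b : Q, Finite (a ⟶ b)] (n : ℕ) :
    {p : QPath Q | p.length = n}.Finite := by
  induction n with
  | zero =>
    refine (Set.finite_range (triv (Q := Q))).subset fun p hp => ⟨p.source, ?_⟩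
    exact (eq_triv_of_length_eq_zero p hp).symm
  | succ n ih =>
    have : Finite {p : QPath Q // p.length = n} := ih.to_subtype
    refine (Set.finite_range (fun x : Σ p : {p : QPath Q // p.length = n}, Σ c : Q,
      (p.1.target ⟶ c) => (⟨x.1.1.source, x.2.1, x.1.1.path.cons x.2.2⟩ : QPath Q))).subset ?_
    rintro ⟨a, b, p⟩ hp
    cases p with
    | nil => simp [length] at hp
    | cons p α => exact ⟨⟨⟨⟨_, _, p⟩, by simpa [length] using hp⟩, _, α⟩, rfl⟩

theorem finite_length_lt [Finite Q] [∀ a b : Q, Finite (a ⟶ b)] (n : ℕ) :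
    {p : QPath Q | p.length < n}.Finite := by
  have : {p : QPath Q | p.length < n} = ⋃ i ∈ Set.Iio n, {p : QPath Q | p.length = i} := by
    ext p
    simp
  rw [this]
  exact (Set.finite_Iio n).biUnion fun i _ => finite_length_eq i

end QPath

/-! ### The normal form of an element of a monomial algebra -/

section NormalForm

variable {k : Type*} [Field k] {Q : Type*} [Quiver Q]

theorem PathAlgebra.repr_ofPath (p : QPath Q) :
    (PathAlgebra.basis k Q).repr (PathAlgebra.ofPath k p) = Finsupp.single p 1 := by
  rw [← PathAlgebra.basis_apply, Module.Basis.repr_self]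

variable [Fintype Q] {I : Ideal (PathAlgebra k Q)}

/-- A monomial ideal contains, together with an element, every path occurring in that element. -/
theorem IsMonomial.ofPath_mem [I.IsTwoSided] (hI : IsMonomial I) {x : PathAlgebra k Q} (hx : x ∈ I)
    (p : QPath Q) (hp : (PathAlgebra.basis k Q).repr x p ≠ 0) : PathAlgebra.ofPath k p ∈ I := by
  obtain ⟨-, S, -, hS⟩ := hI
  have hSI : ∀ p ∈ S, PathAlgebra.ofPath k p ∈ I := by
    intro p hp
    rw [hS, TwoSidedIdeal.mem_asIdeal]
    exact TwoSidedIdeal.subset_span ⟨p, hp, rfl⟩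
  -- the linear span of the paths in `I` is closed under multiplication from both sides
  let N : Submodule k (PathAlgebra k Q) :=
    Submodule.span k {x | x ∈ I ∧ ∃ p, x = PathAlgebra.ofPath k p}
  have hl : ∀ a x, x ∈ N → a * x ∈ N := by
    intro a x hx
    induction hx using Submodule.span_induction with
    | zero => simp
    | add x y _ _ hx hy => rw [mul_add]; exact add_mem hx hy
    | smul c x _ hx => rw [mul_smul_comm]; exact N.smul_mem c hx
    | mem x hx =>
      obtain ⟨hx, p, rfl⟩ := hx
      induction a using PathAlgebra.induction_on with
      | zero => simp
      | add a b ha hb => rw [add_mul]; exact add_mem ha hb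
      | single c r =>
        rw [smul_mul_assoc]
        refine N.smul_mem c ?_
        have hm := I.mul_mem_left (PathAlgebra.ofPath k r) hx
        by_cases h : r.source = p.target
        · rw [PathAlgebra.ofPath_mul_ofPath_of_eq k r p h] at hm ⊢
          exact Submodule.subset_span ⟨hm, _, rfl⟩
        · rw [PathAlgebra.ofPath_mul_ofPath_of_ne k r p h]
          exact zero_mem _
  have hr : ∀ a x, x ∈ N → x * a ∈ N := by
    intro a x hx
    induction hx using Submodule.span_induction with
    | zero => simp
    | add x y _ _ hx hy => rw [add_mul]; exact add_mem hx hy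
    | smul c x _ hx => rw [smul_mul_assoc]; exact N.smul_mem c hx
    | mem x hx =>
      obtain ⟨hx, p, rfl⟩ := hx
      induction a using PathAlgebra.induction_on with
      | zero => simp
      | add a b ha hb => rw [mul_add]; exact add_mem ha hb
      | single c r =>
        rw [mul_smul_comm]
        refine N.smul_mem c ?_
        have hm := I.mul_mem_right (PathAlgebra.ofPath k r) hx
        by_cases h : p.source = r.target
        · rw [PathAlgebra.ofPath_mul_ofPath_of_eq k p r h] at hm ⊢
          exact Submodule.subset_span ⟨hm, _, rfl⟩
        · rw [PathAlgebra.ofPath_mul_ofPath_of_ne k p r h]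
          exact zero_mem _
  have hxN : x ∈ N := by
    rw [hS, TwoSidedIdeal.mem_asIdeal] at hx
    clear hp
    induction hx using TwoSidedIdeal.span_induction with
    | mem x h =>
      obtain ⟨p, hp, rfl⟩ := h
      exact Submodule.subset_span ⟨hSI p hp, p, rfl⟩
    | zero => exact zero_mem _
    | add x y _ _ hx hy => exact add_mem hx hy
    | neg x _ hx => exact neg_mem hx
    | left_absorb a x _ hx => exact hl a x hx
    | right_absorb a x _ hx => exact hr a x hx
  clear hx
  induction hxN using Submodule.span_induction with
  | zero => simp at hp
  | add x y _ _ hx hy =>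
    by_cases h : (PathAlgebra.basis k Q).repr x p = 0
    · refine hy fun h' => hp ?_
      rw [map_add, Finsupp.add_apply, h, h', add_zero]
    · exact hx h
  | smul c x _ hx =>
    refine hx fun h => hp ?_
    rw [map_smul, Finsupp.smul_apply, h, smul_zero]
  | mem x hx =>
    obtain ⟨hx, q, rfl⟩ := hx
    rw [PathAlgebra.repr_ofPath] at hp
    obtain rfl : q = p := by
      by_contra hne
      exact hp (Finsupp.single_eq_of_ne (Ne.symm hne))
    exact hx

variable [I.IsTwoSided]

theorem isNonzeroPath_iff (p : QPath Q) : IsNonzeroPath I p ↔ PathAlgebra.ofPath k p ∉ I := by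
  rw [IsNonzeroPath, pathIn, Ne, Ideal.Quotient.eq_zero_iff_mem]

theorem pathIn_eq_zero {p : QPath Q} (h : ¬ IsNonzeroPath I p) : pathIn I p = 0 :=
  not_not.1 h

theorem pathIn_mul_pathIn (p q : QPath Q) (h : p.source = q.target) :
    pathIn I p * pathIn I q = pathIn I (p.comp q h) := by
  rw [pathIn, pathIn, pathIn, ← map_mul, PathAlgebra.ofPath_mul_ofPath_of_eq k p q h]

theorem pathIn_mul_pathIn_of_ne (p q : QPath Q) (h : p.source ≠ q.target) :
    pathIn I p * pathIn I q = 0 := by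
  rw [pathIn, pathIn, ← map_mul, PathAlgebra.ofPath_mul_ofPath_of_ne k p q h, map_zero]

theorem triv_mul_pathIn (p : QPath Q) : pathIn I (QPath.triv p.target) * pathIn I p = pathIn I p :=
  (pathIn_mul_pathIn (QPath.triv p.target) p rfl).trans
    (congrArg (pathIn I) (QPath.triv_comp _ _ _))

theorem pathIn_mul_triv (p : QPath Q) : pathIn I p * pathIn I (QPath.triv p.source) = pathIn I p :=
  (pathIn_mul_pathIn p (QPath.triv p.source) rfl).trans
    (congrArg (pathIn I) (QPath.comp_triv _ _ _))

theorem IsNonzeroPath.left {p q : QPath Q} {h : p.source = q.target}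
    (hn : IsNonzeroPath I (p.comp q h)) : IsNonzeroPath I p := by
  intro h0
  apply hn
  rw [← pathIn_mul_pathIn, h0, zero_mul]

theorem IsNonzeroPath.right {p q : QPath Q} {h : p.source = q.target}
    (hn : IsNonzeroPath I (p.comp q h)) : IsNonzeroPath I q := by
  intro h0
  apply hn
  rw [← pathIn_mul_pathIn, h0, mul_zero]

theorem IsNonzeroPath.triv_target {p : QPath Q} (hn : IsNonzeroPath I p) :
    IsNonzeroPath I (QPath.triv p.target) := by
  intro h0
  apply hn
  rw [← triv_mul_pathIn, h0, zero_mul]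

open Classical in
/-- The normal form of an element of a monomial algebra `A = kQ/I`: its coordinates with respect to
the basis of `A` consisting of the nonzero paths, extended by zero to all paths. -/
noncomputable def normalForm (hI : IsMonomial I) : (PathAlgebra k Q ⧸ I) →ₗ[k] (QPath Q →₀ k) :=
  ((I.restrictScalars k).liftQ
    ((Finsupp.supported k k {p | IsNonzeroPath I p}).subtype ∘ₗ
      Finsupp.restrictDom k k {p | IsNonzeroPath I p} ∘ₗ
      (PathAlgebra.basis k Q).repr.toLinearMap) (by
    intro x hx
    rw [LinearMap.mem_ker]
    ext p
    change Finsupp.filter (fun p => p ∈ {p | IsNonzeroPath I p})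
      ((PathAlgebra.basis k Q).repr x) p = 0
    by_cases hp : IsNonzeroPath I p
    · rw [Finsupp.filter_apply_pos _ _ (show p ∈ {p | IsNonzeroPath I p} from hp)]
      by_contra h
      exact (isNonzeroPath_iff p).1 hp (hI.ofPath_mem hx p h)
    · rw [Finsupp.filter_apply_neg _ _ (show p ∉ {p | IsNonzeroPath I p} from hp)])) ∘ₗ
  (Submodule.Quotient.restrictScalarsEquiv k I).symm.toLinearMap

variable (hI : IsMonomial I)

theorem normalForm_mk_apply (x : PathAlgebra k Q) {p : QPath Q} (hp : IsNonzeroPath I p) :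
    normalForm hI (Ideal.Quotient.mk I x) p = (PathAlgebra.basis k Q).repr x p := by
  classical
  exact Finsupp.filter_apply_pos (· ∈ {p | IsNonzeroPath I p}) _ hp

theorem normalForm_apply_of_not {p : QPath Q} (hp : ¬ IsNonzeroPath I p)
    (x : PathAlgebra k Q ⧸ I) : normalForm hI x p = 0 := by
  classical
  obtain ⟨x, rfl⟩ := Ideal.Quotient.mk_surjective x
  exact Finsupp.filter_apply_neg (· ∈ {p | IsNonzeroPath I p}) _ hp

theorem isNonzeroPath_of_normalForm_ne_zero {p : QPath Q} {x : PathAlgebra k Q ⧸ I}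
    (h : normalForm hI x p ≠ 0) : IsNonzeroPath I p := by
  by_contra hp
  exact h (normalForm_apply_of_not hI hp x)

theorem normalForm_pathIn {p : QPath Q} (hp : IsNonzeroPath I p) :
    normalForm hI (pathIn I p) = Finsupp.single p 1 := by
  ext q
  by_cases hq : IsNonzeroPath I q
  · rw [pathIn, normalForm_mk_apply hI _ hq, PathAlgebra.repr_ofPath]
  · rw [normalForm_apply_of_not hI hq, Finsupp.single_eq_of_ne]
    rintro rfl
    exact hq hp

theorem normalForm_pathIn_self {p : QPath Q} (hp : IsNonzeroPath I p) :
    normalForm hI (pathIn I p) p = 1 := by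
  rw [normalForm_pathIn hI hp, Finsupp.single_eq_same]

theorem eq_of_normalForm_pathIn_ne_zero {p w : QPath Q}
    (h : normalForm hI (pathIn I p) w ≠ 0) : w = p := by
  by_cases hp : IsNonzeroPath I p
  · by_contra hne
    rw [normalForm_pathIn hI hp, Finsupp.single_eq_of_ne hne] at h
    exact h rfl
  · rw [pathIn_eq_zero hp, map_zero] at h
    exact absurd rfl h

theorem quotient_induction {P : PathAlgebra k Q ⧸ I → Prop} (x : PathAlgebra k Q ⧸ I)
    (zero : P 0) (add : ∀ y z, P y → P z → P (y + z))
    (single : ∀ (c : k) (p : QPath Q), IsNonzeroPath I p → P (c • pathIn I p)) : P x := by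
  obtain ⟨x, rfl⟩ := Ideal.Quotient.mk_surjective x
  induction x using PathAlgebra.induction_on with
  | zero => rwa [map_zero]
  | add y z hy hz => rw [map_add]; exact add _ _ hy hz
  | single c p =>
    have : Ideal.Quotient.mk I (c • PathAlgebra.ofPath k p) = c • pathIn I p := rfl
    rw [this]
    by_cases hp : IsNonzeroPath I p
    · exact single c p hp
    · rwa [pathIn_eq_zero hp, smul_zero]

theorem linearCombination_normalForm (x : PathAlgebra k Q ⧸ I) :
    Finsupp.linearCombination k (pathIn I) (normalForm hI x) = x := by
  induction x using quotient_induction with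
  | zero => simp
  | add y z hy hz => rw [map_add, map_add, hy, hz]
  | single c p hp => 
    rw [map_smul, map_smul, normalForm_pathIn hI hp, Finsupp.linearCombination_single, one_smul]

theorem sum_normalForm (x : PathAlgebra k Q ⧸ I) :
    ∑ p ∈ (normalForm hI x).support, normalForm hI x p • pathIn I p = x :=
  linearCombination_normalForm hI x

theorem ext_normalForm {x y : PathAlgebra k Q ⧸ I}
    (h : ∀ p, normalForm hI x p = normalForm hI y p) : x = y := by
  rw [← linearCombination_normalForm hI x, ← linearCombination_normalForm hI y, Finsupp.ext h]

theorem exists_normalForm_ne_zero {x : PathAlgebra k Q ⧸ I} (hx : x ≠ 0) :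
    ∃ p, normalForm hI x p ≠ 0 := by
  by_contra! h
  exact hx (ext_normalForm hI fun p => by rw [h p, map_zero, Finsupp.zero_apply])

/-- The paths occurring in `xy` are concatenations of paths occurring in `x` and in `y`. -/
theorem exists_comp_of_normalForm_mul_ne_zero {x y : PathAlgebra k Q ⧸ I} {v : QPath Q}
    (h : normalForm hI (x * y) v ≠ 0) : ∃ (w r : QPath Q) (e : w.source = r.target),
      normalForm hI x w ≠ 0 ∧ normalForm hI y r ≠ 0 ∧ v = w.comp r e := by
  by_contra! hcon
  apply h
  conv_lhs => rw [← sum_normalForm hI x, ← sum_normalForm hI y]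
  rw [Finset.sum_mul_sum, map_sum, Finsupp.finsetSum_apply]
  refine Finset.sum_eq_zero fun w hw => ?_
  rw [map_sum, Finsupp.finsetSum_apply]
  refine Finset.sum_eq_zero fun r hr => ?_
  rw [smul_mul_smul_comm, map_smul, Finsupp.smul_apply]
  by_cases e : w.source = r.target
  · rw [pathIn_mul_pathIn w r e]
    by_contra h0
    exact hcon w r e (Finsupp.mem_support_iff.1 hw) (Finsupp.mem_support_iff.1 hr)
      (eq_of_normalForm_pathIn_ne_zero hI fun h' => h0 (by rw [h', smul_zero]))
  · rw [pathIn_mul_pathIn_of_ne w r e, map_zero, Finsupp.zero_apply, smul_zero]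

theorem normalForm_mul_pathIn (x : PathAlgebra k Q ⧸ I) {w p : QPath Q} {h : w.source = p.target}
    (hn : IsNonzeroPath I (w.comp p h)) :
    normalForm hI (x * pathIn I p) (w.comp p h) = normalForm hI x w := by
  induction x using quotient_induction with
  | zero => simp
  | add y z hy hz => rw [add_mul, map_add, map_add, Finsupp.add_apply, Finsupp.add_apply, hy, hz]
  | single c r hr =>
    rw [smul_mul_assoc, map_smul, map_smul, Finsupp.smul_apply, Finsupp.smul_apply]
    congr 1
    by_cases hrw : r = w
    · subst hrw
      rw [pathIn_mul_pathIn _ _ h, normalForm_pathIn_self hI hn, normalForm_pathIn_self hI hr]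
    · rw [normalForm_pathIn hI hr, Finsupp.single_eq_of_ne (Ne.symm hrw)]
      by_contra h0
      obtain ⟨w', p', e, h1, h2, h3⟩ := exists_comp_of_normalForm_mul_ne_zero hI h0
      obtain rfl := eq_of_normalForm_pathIn_ne_zero hI h1
      obtain rfl := eq_of_normalForm_pathIn_ne_zero hI h2
      exact hrw (QPath.comp_right_cancel h3).symm

theorem normalForm_pathIn_mul (x : PathAlgebra k Q ⧸ I) {w p : QPath Q} {h : p.source = w.target}
    (hn : IsNonzeroPath I (p.comp w h)) :
    normalForm hI (pathIn I p * x) (p.comp w h) = normalForm hI x w := by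
  induction x using quotient_induction with
  | zero => simp
  | add y z hy hz => rw [mul_add, map_add, map_add, Finsupp.add_apply, Finsupp.add_apply, hy, hz]
  | single c r hr =>
    rw [mul_smul_comm, map_smul, map_smul, Finsupp.smul_apply, Finsupp.smul_apply]
    congr 1
    by_cases hrw : r = w
    · subst hrw
      rw [pathIn_mul_pathIn _ _ h, normalForm_pathIn_self hI hn, normalForm_pathIn_self hI hr]
    · rw [normalForm_pathIn hI hr, Finsupp.single_eq_of_ne (Ne.symm hrw)]
      by_contra h0
      obtain ⟨w', p', e, h1, h2, h3⟩ := exists_comp_of_normalForm_mul_ne_zero hI h0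
      obtain rfl := eq_of_normalForm_pathIn_ne_zero hI h1
      obtain rfl := eq_of_normalForm_pathIn_ne_zero hI h2
      exact hrw (QPath.comp_left_cancel h3).symm

theorem normalForm_mul_pathIn_self (x : PathAlgebra k Q ⧸ I) {p : QPath Q}
    (hp : IsNonzeroPath I p) :
    normalForm hI (x * pathIn I p) p = normalForm hI x (QPath.triv p.target) := by
  have e := QPath.triv_comp p.target p rfl
  have := normalForm_mul_pathIn hI x (w := QPath.triv p.target) (p := p) (h := rfl) (by rwa [e])
  rwa [e] at this

theorem normalForm_pathIn_mul_self (x : PathAlgebra k Q ⧸ I) {p : QPath Q}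
    (hp : IsNonzeroPath I p) :
    normalForm hI (pathIn I p * x) p = normalForm hI x (QPath.triv p.source) := by
  have e := QPath.comp_triv p.source p rfl
  have := normalForm_pathIn_mul hI x (w := QPath.triv p.source) (p := p) (h := rfl) (by rwa [e])
  rwa [e] at this

/-- If `x` annihilates the path `p` from the left, then so does each path occurring in `x`. -/
theorem pathIn_mul_eq_zero_of_mul_eq_zero {x : PathAlgebra k Q ⧸ I} {p w : QPath Q}
    (h : x * pathIn I p = 0) (hw : normalForm hI x w ≠ 0) : pathIn I w * pathIn I p = 0 := by
  by_cases e : w.source = p.target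
  · by_contra hn
    rw [pathIn_mul_pathIn w p e] at hn
    apply hw
    rw [← normalForm_mul_pathIn hI x hn, h, map_zero, Finsupp.zero_apply]
  · exact pathIn_mul_pathIn_of_ne w p e

theorem pathIn_mul_eq_zero_of_mul_eq_zero' {x : PathAlgebra k Q ⧸ I} {p w : QPath Q}
    (h : pathIn I p * x = 0) (hw : normalForm hI x w ≠ 0) : pathIn I p * pathIn I w = 0 := by
  by_cases e : p.source = w.target
  · by_contra hn
    rw [pathIn_mul_pathIn p w e] at hn
    apply hw
    rw [← normalForm_pathIn_mul hI x hn, h, map_zero, Finsupp.zero_apply]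
  · exact pathIn_mul_pathIn_of_ne p w e

theorem mem_leftIdeal_iff_exists {p : QPath Q} {x : PathAlgebra k Q ⧸ I} :
    x ∈ leftIdeal I p ↔ ∃ a, a * pathIn I p = x :=
  Ideal.mem_span_singleton'

theorem pathIn_mem_leftIdeal (p : QPath Q) : pathIn I p ∈ leftIdeal I p :=
  Ideal.mem_span_singleton_self _

theorem pathIn_mem_leftIdeal_of_mem {p w : QPath Q} (h : w ∈ p.leftMultiples) :
    pathIn I w ∈ leftIdeal I p := by
  obtain ⟨u, hu, rfl⟩ := h
  rw [← pathIn_mul_pathIn]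
  exact Ideal.mul_mem_left _ _ (pathIn_mem_leftIdeal p)

/-- The left ideal `Ap` is spanned by the paths of the form `up`. -/
theorem mem_leftIdeal_iff {p : QPath Q} {x : PathAlgebra k Q ⧸ I} :
    x ∈ leftIdeal I p ↔ ∀ w, normalForm hI x w ≠ 0 → w ∈ p.leftMultiples := by
  constructor
  · rw [mem_leftIdeal_iff_exists]
    rintro ⟨a, rfl⟩ w hw
    obtain ⟨u, r, e, -, hr, rfl⟩ := exists_comp_of_normalForm_mul_ne_zero hI hw
    obtain rfl := eq_of_normalForm_pathIn_ne_zero hI hr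
    exact ⟨u, e, rfl⟩
  · intro h
    rw [← sum_normalForm hI x]
    refine sum_mem fun w hw => ?_
    rw [← one_mul (pathIn I w), ← smul_mul_assoc]
    exact Ideal.mul_mem_left _ _ (pathIn_mem_leftIdeal_of_mem (h w (Finsupp.mem_support_iff.1 hw)))

/-- The right ideal `pA` is spanned by the paths of the form `pu`. -/
theorem exists_eq_pathIn_mul {p : QPath Q} {x : PathAlgebra k Q ⧸ I}
    (h : ∀ w, normalForm hI x w ≠ 0 → w ∈ p.rightMultiples) : ∃ z, x = pathIn I p * z := by
  have h' : ∀ w, ∃ z, normalForm hI x w • pathIn I w = pathIn I p * z := by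
    intro w
    by_cases hw : normalForm hI x w = 0
    · exact ⟨0, by rw [hw, zero_smul, mul_zero]⟩
    · obtain ⟨u, hu, rfl⟩ := h w hw
      exact ⟨_, by rw [← pathIn_mul_pathIn, ← mul_smul_comm]⟩
  choose z hz using h'
  refine ⟨∑ w ∈ (normalForm hI x).support, z w, ?_⟩
  rw [Finset.mul_sum, ← Finset.sum_congr rfl fun w _ => hz w, sum_normalForm]

theorem mul_triv_eq_self_of_mem {i : Q} {x : PathAlgebra k Q ⧸ I}
    (h : x ∈ leftIdeal I (QPath.triv i)) : x * pathIn I (QPath.triv i) = x := by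
  obtain ⟨a, rfl⟩ := mem_leftIdeal_iff_exists.1 h
  rw [mul_assoc]
  congr 1
  exact pathIn_mul_triv (QPath.triv i)

theorem leftIdeal_le_leftIdeal_triv (p : QPath Q) :
    leftIdeal I p ≤ leftIdeal I (QPath.triv p.source) := by
  rw [leftIdeal, Ideal.span_singleton_le_iff_mem, mem_leftIdeal_iff_exists]
  exact ⟨_, pathIn_mul_triv p⟩

theorem pathIn_mem_leftIdeal_triv {p : QPath Q} {i : Q} (h : p.source = i) :
    pathIn I p ∈ leftIdeal I (QPath.triv i) := by
  subst h
  exact leftIdeal_le_leftIdeal_triv p (pathIn_mem_leftIdeal p)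

open Classical in
/-- The part of an element of a monomial algebra which is supported on the set `S` of paths. -/
noncomputable def part (S : Set (QPath Q)) : (PathAlgebra k Q ⧸ I) →ₗ[k] (PathAlgebra k Q ⧸ I) :=
  Finsupp.linearCombination k (pathIn I) ∘ₗ (Finsupp.supported k k S).subtype ∘ₗ
    Finsupp.restrictDom k k S ∘ₗ normalForm hI

open Classical in
theorem normalForm_part (S : Set (QPath Q)) (x : PathAlgebra k Q ⧸ I) (w : QPath Q) :
    normalForm hI (part hI S x) w = if w ∈ S then normalForm hI x w else 0 := by
  induction x using quotient_induction with
  | zero => simp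
  | add y z hy hz =>
    rw [map_add, map_add, map_add, Finsupp.add_apply, Finsupp.add_apply, hy, hz]
    split_ifs <;> simp
  | single c p hp =>
    have : part hI S (pathIn I p) = if p ∈ S then pathIn I p else 0 := by
      change Finsupp.linearCombination k (pathIn I)
        (Finsupp.filter (· ∈ S) (normalForm hI (pathIn I p))) = _
      rw [normalForm_pathIn hI hp]
      split_ifs with h
      · rw [Finsupp.filter_single_of_pos _ h, Finsupp.linearCombination_single, one_smul]
      · rw [Finsupp.filter_single_of_neg _ h, map_zero]
    rw [map_smul, map_smul, map_smul, this, Finsupp.smul_apply, Finsupp.smul_apply]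
    by_cases hw : w = p
    · subst hw
      split_ifs <;> simp
    · split_ifs <;> simp [normalForm_pathIn hI hp, Finsupp.single_eq_of_ne hw]

theorem mem_of_normalForm_part_ne_zero {S : Set (QPath Q)} {x : PathAlgebra k Q ⧸ I} {w : QPath Q}
    (h : normalForm hI (part hI S x) w ≠ 0) : w ∈ S ∧ normalForm hI x w ≠ 0 := by
  rw [normalForm_part] at h
  split_ifs at h with hw
  · exact ⟨hw, h⟩
  · exact absurd rfl h

theorem part_add_part_compl (S : Set (QPath Q)) (x : PathAlgebra k Q ⧸ I) :
    part hI S x + part hI Sᶜ x = x := by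
  classical
  refine ext_normalForm hI fun w => ?_
  rw [map_add, Finsupp.add_apply, normalForm_part, normalForm_part]
  by_cases hw : w ∈ S <;> simp [hw]

theorem part_eq_self {S : Set (QPath Q)} {x : PathAlgebra k Q ⧸ I}
    (h : ∀ w, normalForm hI x w ≠ 0 → w ∈ S) : part hI S x = x := by
  classical
  refine ext_normalForm hI fun w => ?_
  rw [normalForm_part]
  split_ifs with hw
  · rfl
  · by_contra h'
    exact hw (h w (Ne.symm h'))

theorem part_eq_zero {S : Set (QPath Q)} {x : PathAlgebra k Q ⧸ I}
    (h : ∀ w, normalForm hI x w ≠ 0 → w ∉ S) : part hI S x = 0 := by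
  classical
  refine ext_normalForm hI fun w => ?_
  rw [normalForm_part, map_zero, Finsupp.zero_apply]
  split_ifs with hw
  · by_contra h'
    exact h w h' hw
  · rfl

theorem part_pathIn_of_mem {S : Set (QPath Q)} {p : QPath Q} (h : p ∈ S) :
    part hI S (pathIn I p) = pathIn I p :=
  part_eq_self hI fun w hw => by rwa [eq_of_normalForm_pathIn_ne_zero hI hw]

theorem part_pathIn_of_notMem {S : Set (QPath Q)} {p : QPath Q} (h : p ∉ S) :
    part hI S (pathIn I p) = 0 :=
  part_eq_zero hI fun w hw => by rwa [eq_of_normalForm_pathIn_ne_zero hI hw]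

/-- Taking the part in `Aq` commutes with left multiplication on elements in which all paths are
at least as long as `q`. -/
theorem part_leftMultiples_mul (y : PathAlgebra k Q ⧸ I) {z : PathAlgebra k Q ⧸ I} {q : QPath Q}
    (hz : ∀ w, normalForm hI z w ≠ 0 → q.length ≤ w.length) :
    part hI q.leftMultiples (y * z) = y * part hI q.leftMultiples z := by
  conv_lhs => rw [← part_add_part_compl hI q.leftMultiples z]
  rw [mul_add, map_add, part_eq_self hI (x := y * part hI q.leftMultiples z),
    part_eq_zero hI (x := y * part hI q.leftMultiplesᶜ z), add_zero]
  · intro v hv hm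
    obtain ⟨r, w, e, -, hw, rfl⟩ := exists_comp_of_normalForm_mul_ne_zero hI hv
    obtain ⟨hw, hw'⟩ := mem_of_normalForm_part_ne_zero hI hw
    exact hw (QPath.mem_leftMultiples_of_comp_mem hm (hz w hw'))
  · intro v hv
    obtain ⟨r, w, e, -, hw, rfl⟩ := exists_comp_of_normalForm_mul_ne_zero hI hv
    exact QPath.comp_mem_leftMultiples r e (mem_of_normalForm_part_ne_zero hI hw).1

/-- Taking the part in `pA` commutes with right multiplication on elements in which all paths are
at least as long as `p`. -/
theorem part_rightMultiples_mul {y : PathAlgebra k Q ⧸ I} (z : PathAlgebra k Q ⧸ I) {p : QPath Q}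
    (hy : ∀ w, normalForm hI y w ≠ 0 → p.length ≤ w.length) :
    part hI p.rightMultiples (y * z) = part hI p.rightMultiples y * z := by
  conv_lhs => rw [← part_add_part_compl hI p.rightMultiples y]
  rw [add_mul, map_add, part_eq_self hI (x := part hI p.rightMultiples y * z),
    part_eq_zero hI (x := part hI p.rightMultiplesᶜ y * z), add_zero]
  · intro v hv hm
    obtain ⟨w, r, e, hw, -, rfl⟩ := exists_comp_of_normalForm_mul_ne_zero hI hv
    obtain ⟨hw, hw'⟩ := mem_of_normalForm_part_ne_zero hI hw
    exact hw (QPath.mem_rightMultiples_of_comp_mem hm (hy w hw'))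
  · intro v hv
    obtain ⟨w, r, e, hw, -, rfl⟩ := exists_comp_of_normalForm_mul_ne_zero hI hv
    exact QPath.comp_mem_rightMultiples r e (mem_of_normalForm_part_ne_zero hI hw).1

/-! ### Nilpotency of the radical -/

omit [I.IsTwoSided] in
theorem ofPath_mem_arrowIdeal_pow (n : ℕ) (p : QPath Q) (h : p.length = n) :
    PathAlgebra.ofPath k p ∈ arrowIdeal k Q ^ n := by
  induction n generalizing p with
  | zero =>
    rw [Submodule.pow_zero, Ideal.one_eq_top]
    exact Submodule.mem_top
  | succ n ih =>
    obtain ⟨a, b, p⟩ := p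
    cases p with
    | nil => simp [QPath.length] at h
    | cons p α =>
      have e : PathAlgebra.ofPath k (⟨a, b, p.cons α⟩ : QPath Q) =
          PathAlgebra.ofPath k (QPath.ofArrow α) * PathAlgebra.ofPath k ⟨a, _, p⟩ := by
        rw [PathAlgebra.ofPath_mul_ofPath_of_eq k (QPath.ofArrow α) ⟨a, _, p⟩ rfl]
        rfl
      have hα : PathAlgebra.ofPath k (QPath.ofArrow α) ∈ arrowIdeal k Q := by
        rw [arrowIdeal, TwoSidedIdeal.mem_asIdeal]
        exact TwoSidedIdeal.subset_span ⟨_, _, α, rfl⟩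
      rw [e]
      rcases Nat.eq_zero_or_pos n with rfl | hn
      · rw [zero_add, Submodule.pow_one]
        rw [arrowIdeal] at hα ⊢
        exact Ideal.mul_mem_right _ _ hα
      · rw [Submodule.pow_succ' _ hn.ne']
        exact Ideal.mul_mem_mul hα (ih ⟨a, _, p⟩ (by simpa [QPath.length] using h))

include hI in
/-- The lengths of the nonzero paths are bounded. -/
theorem exists_forall_length_lt : ∃ d : ℕ, ∀ p : QPath Q, IsNonzeroPath I p → p.length < d := by
  obtain ⟨⟨d, -, hd, -⟩, -⟩ := hI
  refine ⟨d, fun p hp => ?_⟩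
  by_contra! h
  refine (isNonzeroPath_iff p).1 hp (hd ?_)
  exact Ideal.pow_le_pow_right h (ofPath_mem_arrowIdeal_pow _ p rfl)

include hI in
theorem finite_isNonzeroPath [∀ a b : Q, Finite (a ⟶ b)] :
    {p : QPath Q | IsNonzeroPath I p}.Finite := by
  obtain ⟨d, hd⟩ := exists_forall_length_lt hI
  exact (QPath.finite_length_lt d).subset fun p hp => hd p hp

/-- An element in which no trivial path occurs is nilpotent. -/
theorem isNilpotent_of_forall_length_pos {x : PathAlgebra k Q ⧸ I}
    (hx : ∀ w, normalForm hI x w ≠ 0 → 1 ≤ w.length) : IsNilpotent x := by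
  obtain ⟨d, hd⟩ := exists_forall_length_lt hI
  have key : ∀ n : ℕ, ∀ w, normalForm hI (x ^ n) w ≠ 0 → n ≤ w.length := by
    intro n
    induction n with
    | zero => exact fun _ _ => Nat.zero_le _
    | succ n ih =>
      intro w hw
      rw [pow_succ] at hw
      obtain ⟨u, v, e, hu, hv, rfl⟩ := exists_comp_of_normalForm_mul_ne_zero hI hw
      rw [QPath.length_comp]
      exact Nat.add_le_add (ih u hu) (hx v hv)
  refine ⟨d, by_contra fun hne => ?_⟩
  obtain ⟨w, hw⟩ := exists_normalForm_ne_zero hI hne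
  have h1 := key d w hw
  have h2 := hd w (isNonzeroPath_of_normalForm_ne_zero hI hw)
  omega

/-- An element of `Ap` in which `p` occurs is a unit multiple of `p`. -/
theorem exists_unit_mul_eq {p : QPath Q} {y : PathAlgebra k Q ⧸ I} (hy : y ∈ leftIdeal I p)
    (hp : normalForm hI y p ≠ 0) : ∃ u : (PathAlgebra k Q ⧸ I)ˣ, u * y = pathIn I p := by
  obtain ⟨a, rfl⟩ := mem_leftIdeal_iff_exists.1 hy
  have hpn := isNonzeroPath_of_normalForm_ne_zero hI hp
  rw [normalForm_mul_pathIn_self hI a hpn] at hp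
  set c := normalForm hI a (QPath.triv p.target) with hc
  set n := part hI {w | 1 ≤ w.length} a with hn
  have hnil : IsNilpotent n := isNilpotent_of_forall_length_pos hI fun w hw =>
    (mem_of_normalForm_part_ne_zero hI hw).1
  -- the trivial paths at the other vertices annihilate `p`
  have hap : a * pathIn I p = (algebraMap k (PathAlgebra k Q ⧸ I) c + n) * pathIn I p := by
    have h1 : part hI {w | 1 ≤ w.length}ᶜ a * pathIn I p = c • pathIn I p := by
      rw [← sum_normalForm hI (part hI {w | 1 ≤ w.length}ᶜ a), Finset.sum_mul]
      have h2 : ∀ w, normalForm hI (part hI {w | 1 ≤ w.length}ᶜ a) w ≠ 0 →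
          w ≠ QPath.triv p.target → pathIn I w * pathIn I p = 0 := by
        intro w hw hne
        have hl : w.length = 0 := by
          have := (mem_of_normalForm_part_ne_zero hI hw).1
          simpa using this
        refine pathIn_mul_pathIn_of_ne w p fun e => hne ?_
        rw [QPath.eq_triv_of_length_eq_zero w hl, e]
      rw [Finset.sum_eq_single (QPath.triv p.target)]
      · rw [normalForm_part, if_pos (by simp), smul_mul_assoc, triv_mul_pathIn]
      · intro w hw hne
        rw [smul_mul_assoc, h2 w (Finsupp.mem_support_iff.1 hw) hne, smul_zero]
      · intro h
        rw [Finsupp.notMem_support_iff.1 h, zero_smul, zero_mul]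
    conv_lhs => rw [← part_add_part_compl hI {w | 1 ≤ w.length} a]
    rw [add_mul, h1, add_mul, Algebra.algebraMap_eq_smul_one, smul_mul_assoc, one_mul, add_comm]
  have hu : IsUnit (algebraMap k (PathAlgebra k Q ⧸ I) c + n) :=
    hnil.isUnit_add_left_of_commute ((IsUnit.mk0 c hp).map _) (Algebra.commutes c n).symm
  obtain ⟨u, hu⟩ := hu
  refine ⟨u⁻¹, ?_⟩
  rw [hap, ← hu, ← mul_assoc, Units.inv_mul, one_mul]

end NormalForm

/-! ### Totally acyclic complexes -/

section TotallyAcyclic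

universe u v

variable {R : Type u} [Ring R]

/-- Totally acyclic complexes of finitely generated projective modules, that is, the complexes
occurring in the definition of Gorenstein-projective modules. -/
structure IsTotallyAcyclic (P : ℤ → ModuleCat.{u} R) (d : ∀ i : ℤ, P i →ₗ[R] P (i + 1)) :
    Prop where
  finite : ∀ i, Module.Finite R (P i)
  projective : ∀ i, Module.Projective R (P i)
  exact : ∀ i, Function.Exact (d i) (d (i + 1))
  exact_dual : ∀ i, Function.Exact (fun f : P (i + 1 + 1) →ₗ[R] R => f ∘ₗ d (i + 1))
    (fun f : P (i + 1) →ₗ[R] R => f ∘ₗ d i)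

theorem isGorensteinProjective_iff {M : Type v} [AddCommGroup M] [Module R M] :
    IsGorensteinProjective R M ↔ ∃ (P : ℤ → ModuleCat.{u} R) (d : ∀ i : ℤ, P i →ₗ[R] P (i + 1)),
      IsTotallyAcyclic P d ∧ ∃ i, Nonempty (M ≃ₗ[R] LinearMap.ker (d i)) :=
  ⟨fun ⟨P, d, h1, h2, h3, h4⟩ => ⟨P, d, ⟨fun i => (h1 i).1, fun i => (h1 i).2, h2, h3⟩, h4⟩,
    fun ⟨P, d, h, h4⟩ => ⟨P, d, fun i => ⟨h.finite i, h.projective i⟩, h.exact, h.exact_dual, h4⟩⟩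

/-- A map `f` into the middle term of a short exact sequence which is killed by the second map
lifts to the first term. -/
theorem exists_lift_of_exact {K P X M : Type*} [AddCommGroup K] [Module R K] [AddCommGroup P]
    [Module R P] [AddCommGroup X] [Module R X] [AddCommGroup M] [Module R M] {ι : K →ₗ[R] P}
    {ε : P →ₗ[R] X} (hι : Function.Injective ι) (hex : Function.Exact ι ε) (f : M →ₗ[R] P)
    (hf : ∀ m, ε (f m) = 0) : ∃ f' : M →ₗ[R] K, ∀ m, ι (f' m) = f m := by
  refine ⟨(LinearEquiv.ofInjective ι hι).symm.toLinearMap ∘ₗ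
    f.codRestrict (LinearMap.range ι) fun m => (hex _).1 (hf m), fun m => ?_⟩
  have := congrArg Subtype.val ((LinearEquiv.ofInjective ι hι).apply_symm_apply
    (f.codRestrict (LinearMap.range ι) (fun m => (hex _).1 (hf m)) m))
  exact this

theorem projective_lift {P M N : Type*} [AddCommGroup P] [Module R P] [AddCommGroup M] [Module R M]
    [AddCommGroup N] [Module R N] (hP : Module.Projective R P) (f : M →ₗ[R] N) (g : P →ₗ[R] N)
    (hf : Function.Surjective f) : ∃ h : P →ₗ[R] M, ∀ x, f (h x) = g x := by
  obtain ⟨h, hh⟩ := Module.projective_lifting_property f g hf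
  exact ⟨h, fun x => congrArg (· x) hh⟩

/-- In a finitely generated projective module there are enough functionals. -/
theorem exists_dual_ne_zero {P : Type*} [AddCommGroup P] [Module R P] [Module.Finite R P]
    [Module.Projective R P] {x : P} (hx : x ≠ 0) : ∃ g : P →ₗ[R] R, g x ≠ 0 := by
  obtain ⟨n, f, g, -, -, hfg⟩ := Module.Finite.exists_comp_eq_id_of_projective R P
  by_contra! h
  apply hx
  have hg : g x = 0 := funext fun l => h (LinearMap.proj l ∘ₗ g)
  rw [← LinearMap.id_apply (R := R) x, ← hfg, LinearMap.comp_apply, hg, map_zero]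

/-- Let `φ` be a right-linear functional on the dual of `N`. Its composition with the dual of a map
`t : N → P` to a finitely generated projective module is evaluation at an element of `P`. -/
theorem exists_eval_of_projective {P N : Type*} [AddCommGroup P] [Module R P] [AddCommGroup N]
    [Module R N] [Module.Finite R P] [Module.Projective R P] (t : N →ₗ[R] P)
    (φ : (N →ₗ[R] R) →+ R)
    (hφ : ∀ g y, φ (LinearMap.toSpanSingleton R R y ∘ₗ g) = φ g * y) :
    ∃ x : P, ∀ g : P →ₗ[R] R, g x = φ (g ∘ₗ t) := by
  obtain ⟨n, f, s, -, -, hfs⟩ := Module.Finite.exists_comp_eq_id_of_projective R P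
  refine ⟨f fun l => φ (LinearMap.proj l ∘ₗ s ∘ₗ t), fun g => ?_⟩
  have key : ∀ y : Fin n → R, g (f y) = ∑ l, y l * g (f (Pi.single l 1)) := by
    intro y
    conv_lhs => rw [pi_eq_sum_univ' y]
    simp only [map_sum, map_smul, smul_eq_mul]
  rw [key]
  simp_rw [← hφ]
  rw [← map_sum]
  congr 1
  ext x
  have hx : f (s (t x)) = t x := congrArg (· (t x)) hfs
  rw [LinearMap.comp_apply, ← hx, key]
  simp [LinearMap.sum_apply]

namespace IsTotallyAcyclic

variable {P : ℤ → ModuleCat.{u} R} {d : ∀ i : ℤ, P i →ₗ[R] P (i + 1)} (hd : IsTotallyAcyclic P d)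

/-- The differential as a map onto the cocycles. -/
def toKer (hd : IsTotallyAcyclic P d) (j : ℤ) : P j →ₗ[R] LinearMap.ker (d (j + 1)) :=
  (d j).codRestrict _ fun x => (hd.exact j _).2 ⟨x, rfl⟩

include hd

theorem toKer_surjective (j : ℤ) : Function.Surjective (hd.toKer j) := by
  rintro ⟨y, hy⟩
  obtain ⟨x, rfl⟩ := (hd.exact j y).1 hy
  exact ⟨x, rfl⟩

theorem exact_subtype_toKer (j : ℤ) :
    Function.Exact (LinearMap.ker (d j)).subtype (hd.toKer j) := by
  refine LinearMap.exact_iff.2 ?_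
  rw [Submodule.range_subtype]
  exact LinearMap.ker_codRestrict _ _ _

/-- Functionals on the cocycles extend, since the dual complex is acyclic. -/
theorem exists_extension (j : ℤ) (h : LinearMap.ker (d j) →ₗ[R] R) :
    ∃ g : P j →ₗ[R] R, ∀ x : LinearMap.ker (d j), g x = h x := by
  obtain ⟨i, rfl⟩ : ∃ i, j = i + 1 + 1 := ⟨j - 2, by ring⟩
  obtain ⟨g, hg⟩ := (hd.exact_dual i (h ∘ₗ hd.toKer (i + 1))).1 (by
    ext x
    have : hd.toKer (i + 1) (d i x) = 0 :=
      Subtype.ext ((hd.exact i _).2 ⟨x, rfl⟩)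
    simp [this])
  refine ⟨g, fun x => ?_⟩
  obtain ⟨y, rfl⟩ := hd.toKer_surjective (i + 1) x
  exact congrArg (· y) hg

/-- The module of cocycles of a totally acyclic complex is reflexive. -/
theorem exists_eval (i : ℤ) (φ : (LinearMap.ker (d i) →ₗ[R] R) →+ R)
    (hφ : ∀ g y, φ (LinearMap.toSpanSingleton R R y ∘ₗ g) = φ g * y) :
    ∃ m : LinearMap.ker (d i), ∀ g : LinearMap.ker (d i) →ₗ[R] R, g m = φ g := by
  have := hd.finite
  have := hd.projective
  obtain ⟨x, hx⟩ := exists_eval_of_projective (LinearMap.ker (d i)).subtype φ hφ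
  have hdx : d i x = 0 := by
    by_contra hne
    obtain ⟨g, hg⟩ := exists_dual_ne_zero (R := R) hne
    apply hg
    have h0 : (g ∘ₗ d i) ∘ₗ (LinearMap.ker (d i)).subtype = 0 := by
      ext y
      simp
    have := hx (g ∘ₗ d i)
    rwa [h0, map_zero] at this
  refine ⟨⟨x, hdx⟩, fun h => ?_⟩
  obtain ⟨g, hg⟩ := hd.exists_extension i h
  have h0 : g ∘ₗ (LinearMap.ker (d i)).subtype = h := LinearMap.ext hg
  rw [← h0, ← hx]
  rfl

end IsTotallyAcyclic

/-- Gorenstein-projective modules are torsionless. -/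
theorem IsGorensteinProjective.exists_dual_ne_zero {M : Type*} [AddCommGroup M] [Module R M]
    (hM : IsGorensteinProjective R M) {m : M} (hm : m ≠ 0) : ∃ g : M →ₗ[R] R, g m ≠ 0 := by
  obtain ⟨P, d, hd, i, ⟨e⟩⟩ := isGorensteinProjective_iff.1 hM
  have := hd.finite
  have := hd.projective
  have hne : (e m : P i) ≠ 0 := by simpa using hm
  obtain ⟨g, hg⟩ := MonomialGorenstein.exists_dual_ne_zero (R := R) hne
  exact ⟨g ∘ₗ (LinearMap.ker (d i)).subtype ∘ₗ e.toLinearMap, hg⟩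

/-- Gorenstein-projective modules are reflexive: each right-linear functional on the dual is an
evaluation. -/
theorem IsGorensteinProjective.exists_eval {M : Type*} [AddCommGroup M] [Module R M]
    (hM : IsGorensteinProjective R M) (φ : (M →ₗ[R] R) →+ R)
    (hφ : ∀ g y, φ (LinearMap.toSpanSingleton R R y ∘ₗ g) = φ g * y) :
    ∃ m : M, ∀ g : M →ₗ[R] R, g m = φ g := by
  obtain ⟨P, d, hd, i, ⟨e⟩⟩ := isGorensteinProjective_iff.1 hM
  obtain ⟨m, hm⟩ := hd.exists_eval i
    { toFun := fun g => φ (g ∘ₗ e.toLinearMap)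
      map_zero' := by simp
      map_add' := fun g g' => by simp [LinearMap.add_comp] } fun g y => by
        simp [← LinearMap.comp_assoc, ← hφ]
  refine ⟨e.symm m, fun g => ?_⟩
  have := hm (g ∘ₗ e.symm.toLinearMap)
  simpa [LinearMap.comp_assoc] using this

/-- `X` is a direct summand of `Z` in the stable category, that is, up to maps factoring through a
projective module. -/
def IsStableRetract (Z X : Type u) [AddCommGroup Z] [Module R Z] [AddCommGroup X] [Module R X] :
    Prop :=
  ∃ (a : X →ₗ[R] Z) (b : Z →ₗ[R] X) (T : Type u) (_ : AddCommGroup T) (_ : Module R T)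
    (_ : Module.Projective R T) (u : X →ₗ[R] T) (v : T →ₗ[R] X), ∀ x, b (a x) = x + v (u x)

theorem IsStableRetract.of_equiv {Z X : Type u} [AddCommGroup Z] [Module R Z] [AddCommGroup X]
    [Module R X] (e : X ≃ₗ[R] Z) : IsStableRetract (R := R) Z X :=
  ⟨e.toLinearMap, e.symm.toLinearMap, R, inferInstance, inferInstance, inferInstance, 0, 0, by simp⟩

/-- A stable retraction lifts to projective presentations. -/
theorem IsStableRetract.exists_lift {Z X K P K' P' : Type u} [AddCommGroup Z] [Module R Z]
    [AddCommGroup X] [Module R X] [AddCommGroup K] [Module R K] [AddCommGroup P] [Module R P]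
    [AddCommGroup K'] [Module R K'] [AddCommGroup P'] [Module R P']
    (h : IsStableRetract (R := R) Z X) (hP : Module.Projective R P) (hP' : Module.Projective R P')
    {ι : K →ₗ[R] P} {ε : P →ₗ[R] X} (hι : Function.Injective ι) (hex : Function.Exact ι ε)
    (hε : Function.Surjective ε) {ι' : K' →ₗ[R] P'} {ε' : P' →ₗ[R] Z}
    (hι' : Function.Injective ι') (hex' : Function.Exact ι' ε') (hε' : Function.Surjective ε') :
    ∃ (α : P →ₗ[R] P') (a : K →ₗ[R] K') (b : K' →ₗ[R] K) (s : P →ₗ[R] K),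
      (∀ x, ι' (a x) = α (ι x)) ∧ ∀ x, b (a x) = x + s (ι x) := by
  obtain ⟨a, b, T, _, _, hT, u, v, hab⟩ := h
  obtain ⟨α, hα⟩ := projective_lift hP ε' (a ∘ₗ ε) hε'
  obtain ⟨β, hβ⟩ := projective_lift hP' ε (b ∘ₗ ε') hε
  obtain ⟨v', hv'⟩ := projective_lift hT ε v hε
  have h0 : ∀ x, ε (ι x) = 0 := fun x => (hex _).2 ⟨x, rfl⟩
  have h0' : ∀ x, ε' (ι' x) = 0 := fun x => (hex' _).2 ⟨x, rfl⟩
  obtain ⟨a', ha'⟩ := exists_lift_of_exact hι' hex' (α ∘ₗ ι) fun x => by simp [hα, h0]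
  obtain ⟨b', hb'⟩ := exists_lift_of_exact hι hex (β ∘ₗ ι') fun x => by simp [hβ, h0']
  obtain ⟨s, hs⟩ := exists_lift_of_exact hι hex (β ∘ₗ α - LinearMap.id - v' ∘ₗ u ∘ₗ ε)
    fun x => by simp [hα, hβ, hv', hab]
  refine ⟨α, a', b', s, ha', fun x => hι ?_⟩
  rw [map_add, hs, hb', LinearMap.comp_apply, ha']
  simp [h0]

/-- Let `K` be the kernel of a projective presentation of a stable retract of a module of cocycles
of a totally acyclic complex. Then functionals on `K` extend, and `K` is again such a stable
retract. -/
theorem IsTotallyAcyclic.extension_and_syzygy {P : ℤ → ModuleCat.{u} R}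
    {d : ∀ i : ℤ, P i →ₗ[R] P (i + 1)} (hd : IsTotallyAcyclic P d) {X K T : Type u}
    [AddCommGroup X] [Module R X] [AddCommGroup K] [Module R K] [AddCommGroup T] [Module R T]
    (hT : Module.Projective R T) {ι : K →ₗ[R] T} {ε : T →ₗ[R] X} (hι : Function.Injective ι)
    (hex : Function.Exact ι ε) (hε : Function.Surjective ε)
    (hX : ∃ j, IsStableRetract (R := R) (LinearMap.ker (d j)) X) :
    (∀ h : K →ₗ[R] R, ∃ g : T →ₗ[R] R, ∀ x, g (ι x) = h x) ∧
      ∃ j, IsStableRetract (R := R) (LinearMap.ker (d j)) K := by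
  obtain ⟨j, hX⟩ := hX
  obtain ⟨i, rfl⟩ : ∃ i, j = i + 1 := ⟨j - 1, by ring⟩
  obtain ⟨α, a, b, s, ha, hab⟩ := hX.exists_lift hT (hd.projective i) hι hex hε
    (Submodule.subtype_injective _) (hd.exact_subtype_toKer i) (hd.toKer_surjective i)
  refine ⟨fun h => ?_, i, a, b, T, inferInstance, inferInstance, hT, ι, s, hab⟩
  obtain ⟨g, hg⟩ := hd.exists_extension i (h ∘ₗ b)
  refine ⟨g ∘ₗ α - h ∘ₗ s, fun x => ?_⟩
  rw [LinearMap.sub_apply, LinearMap.comp_apply, LinearMap.comp_apply, ← ha, Submodule.subtype_apply,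
    hg, LinearMap.comp_apply, hab, map_add, add_sub_cancel_right]

end TotallyAcyclic

/-! ### The modules `Ap` -/

section Modules

variable {k : Type*} [Field k] {Q : Type*} [Quiver Q] [Fintype Q]
  {I : Ideal (PathAlgebra k Q)} [I.IsTwoSided]

theorem isCompl_range_ker_of_leftInverse {R M N : Type*} [Ring R] [AddCommGroup M] [Module R M]
    [AddCommGroup N] [Module R N] {f : M →ₗ[R] N} {s : N →ₗ[R] M} (h : ∀ x, f (s x) = x) :
    IsCompl (LinearMap.range s) (LinearMap.ker f) := by
  constructor
  · rw [Submodule.disjoint_def]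
    rintro _ ⟨x, rfl⟩ hx
    rw [LinearMap.mem_ker, h] at hx
    rw [hx, map_zero]
  · rw [codisjoint_iff, eq_top_iff]
    intro x _
    rw [Submodule.mem_sup]
    exact ⟨s (f x), ⟨_, rfl⟩, x - s (f x), by simp [h], by simp⟩

/-- Right multiplication by an element `a` of the left ideal `N`, as a linear map from the left
ideal `J` to `N`. -/
def mulRightTo {R : Type*} [Ring R] (J N : Ideal R) (a : R) (ha : a ∈ N) : J →ₗ[R] N :=
  (LinearMap.toSpanSingleton R R a ∘ₗ J.subtype).codRestrict N fun x => N.mul_mem_left x ha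

@[simp] theorem coe_mulRightTo {R : Type*} [Ring R] (J N : Ideal R) (a : R) (ha : a ∈ N) (x : J) :
    (mulRightTo J N a ha x : R) = x * a := rfl

theorem mulRightTo_triv_surjective (p : QPath Q) :
    Function.Surjective (mulRightTo (leftIdeal I (QPath.triv p.target)) (leftIdeal I p)
      (pathIn I p) (pathIn_mem_leftIdeal p)) := by
  rintro ⟨_, hx⟩
  obtain ⟨a, rfl⟩ := mem_leftIdeal_iff_exists.1 hx
  refine ⟨⟨a * pathIn I (QPath.triv p.target), Ideal.mul_mem_left _ _ (pathIn_mem_leftIdeal _)⟩, ?_⟩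
  ext
  rw [coe_mulRightTo, mul_assoc, triv_mul_pathIn]

instance finite_leftIdeal (p : QPath Q) : Module.Finite (PathAlgebra k Q ⧸ I) (leftIdeal I p) :=
  Module.Finite.iff_fg.2 (Submodule.fg_span_singleton _)

instance projective_leftIdeal_triv (i : Q) :
    Module.Projective (PathAlgebra k Q ⧸ I) (leftIdeal I (QPath.triv i)) := by
  refine Module.Projective.of_split (leftIdeal I (QPath.triv i)).subtype
    ((LinearMap.toSpanSingleton _ _ (pathIn I (QPath.triv i))).codRestrict _ fun x =>
      Ideal.mul_mem_left _ x (pathIn_mem_leftIdeal _)) ?_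
  ext x
  exact mul_triv_eq_self_of_mem x.2

/-- A functional on `Ae_i` is given by right multiplication. -/
theorem apply_eq_mul_of_leftIdeal_triv {i : Q}
    (g : leftIdeal I (QPath.triv i) →ₗ[PathAlgebra k Q ⧸ I] PathAlgebra k Q ⧸ I)
    (x : leftIdeal I (QPath.triv i)) :
    g x = x * g ⟨pathIn I (QPath.triv i), pathIn_mem_leftIdeal _⟩ := by
  have : x = (x : PathAlgebra k Q ⧸ I) •
      (⟨pathIn I (QPath.triv i), pathIn_mem_leftIdeal _⟩ : leftIdeal I (QPath.triv i)) :=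
    Subtype.ext (mul_triv_eq_self_of_mem x.2).symm
  conv_lhs => rw [this, map_smul]
  rfl

variable (hI : IsMonomial I)

theorem source_eq_of_mem_leftIdeal_triv {i : Q} {x : PathAlgebra k Q ⧸ I}
    (hx : x ∈ leftIdeal I (QPath.triv i)) {w : QPath Q} (hw : normalForm hI x w ≠ 0) :
    w.source = i :=
  QPath.source_eq_of_mem_leftMultiples ((mem_leftIdeal_iff hI).1 hx w hw)

theorem target_eq_of_triv_mul_eq {i : Q} {x : PathAlgebra k Q ⧸ I}
    (hx : pathIn I (QPath.triv i) * x = x) {w : QPath Q} (hw : normalForm hI x w ≠ 0) :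
    w.target = i := by
  rw [← hx] at hw
  obtain ⟨u, r, e, hu, -, rfl⟩ := exists_comp_of_normalForm_mul_ne_zero hI hw
  exact congrArg QPath.target (eq_of_normalForm_pathIn_ne_zero hI hu)

include hI in
theorem eq_top_of_normalForm_ne_zero {p : QPath Q}
    (N : Submodule (PathAlgebra k Q ⧸ I) (leftIdeal I p)) {y : leftIdeal I p} (hy : y ∈ N)
    (hp : normalForm hI y p ≠ 0) : N = ⊤ := by
  obtain ⟨u, hu⟩ := exists_unit_mul_eq hI y.2 hp
  rw [eq_top_iff]
  rintro ⟨_, hx⟩ -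
  obtain ⟨a, rfl⟩ := mem_leftIdeal_iff_exists.1 hx
  have : (⟨a * pathIn I p, hx⟩ : leftIdeal I p) = (a * u) • y := by
    refine Subtype.ext ?_
    change a * pathIn I p = a * u * y
    rw [mul_assoc, hu]
  rw [this]
  exact N.smul_mem _ hy

include hI in
/-- The module `Ap` is indecomposable, since it is local. -/
theorem isIndecomposable_leftIdeal {p : QPath Q} (hp : IsNonzeroPath I p) :
    IsIndecomposable (PathAlgebra k Q ⧸ I) (leftIdeal I p) := by
  refine ⟨⟨⟨⟨pathIn I p, pathIn_mem_leftIdeal p⟩, 0, fun h => hp (congrArg Subtype.val h)⟩⟩, ?_⟩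
  intro N₁ N₂ hN
  have hmem : (⟨pathIn I p, pathIn_mem_leftIdeal p⟩ : leftIdeal I p) ∈ N₁ ⊔ N₂ := by
    rw [hN.sup_eq_top]
    exact Submodule.mem_top
  obtain ⟨x, hx, y, hy, hxy⟩ := Submodule.mem_sup.1 hmem
  have h1 : normalForm hI x p + normalForm hI y p = 1 := by
    rw [← Finsupp.add_apply, ← map_add, ← normalForm_pathIn_self hI hp]
    congr 2
    exact congrArg Subtype.val hxy
  by_cases hx0 : normalForm hI x p = 0
  · have hy0 : normalForm hI y p ≠ 0 := by
      rw [hx0, zero_add] at h1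
      rw [h1]
      exact one_ne_zero
    have := eq_top_of_normalForm_ne_zero hI N₂ hy hy0
    subst this
    exact Or.inl (eq_bot_of_isCompl_top hN)
  · have := eq_top_of_normalForm_ne_zero hI N₁ hx hx0
    subst this
    exact Or.inr (eq_bot_of_top_isCompl hN)

include hI in
/-- If `Ap` is projective, then right multiplication by `p` is injective on `Ae`, since this left
ideal is indecomposable. -/
theorem eq_zero_of_mul_pathIn_eq_zero_of_projective {p : QPath Q} (hp : IsNonzeroPath I p)
    (hproj : Module.Projective (PathAlgebra k Q ⧸ I) (leftIdeal I p)) {x : PathAlgebra k Q ⧸ I}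
    (hx : x ∈ leftIdeal I (QPath.triv p.target)) (hxp : x * pathIn I p = 0) : x = 0 := by
  obtain ⟨s, hs⟩ := projective_lift hproj _ LinearMap.id (mulRightTo_triv_surjective (I := I) p)
  rcases (isIndecomposable_leftIdeal hI hp.triv_target).2 _ _
    (isCompl_range_ker_of_leftInverse hs) with h | h
  · have h0 := hs ⟨pathIn I p, pathIn_mem_leftIdeal p⟩
    rw [LinearMap.range_eq_bot.1 h, LinearMap.zero_apply, map_zero] at h0
    exact absurd (congrArg Subtype.val h0).symm hp
  · have hmem : (⟨x, hx⟩ : leftIdeal I (QPath.triv p.target)) ∈ LinearMap.ker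
        (mulRightTo (leftIdeal I (QPath.triv p.target)) (leftIdeal I p)
          (pathIn I p) (pathIn_mem_leftIdeal p)) := Subtype.ext hxp
    rw [h, Submodule.mem_bot] at hmem
    exact congrArg Subtype.val hmem

/-! ### Perfect pairs -/

include hI in
/-- For a perfect pair `(p, q)`, the left annihilator of `q` in `Ae` is `Ap`. -/
theorem IsPerfectPair.mem_leftIdeal {p q : QPath Q} (h : IsPerfectPair I p q)
    {x : PathAlgebra k Q ⧸ I} (hx : x ∈ leftIdeal I (QPath.triv q.target))
    (hxq : x * pathIn I q = 0) : x ∈ leftIdeal I p := by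
  rw [mem_leftIdeal_iff hI]
  intro w hw
  obtain ⟨u, hu, e⟩ := h.left_unique w (isNonzeroPath_of_normalForm_ne_zero hI hw)
    (source_eq_of_mem_leftIdeal_triv hI hx hw) (pathIn_mul_eq_zero_of_mul_eq_zero hI hxq hw)
  exact ⟨u, hu, e⟩

include hI in
/-- For a perfect pair `(p, q)`, the right annihilator of `p` in `eA` is `qA`. -/
theorem IsPerfectPair.exists_eq_mul {p q : QPath Q} (h : IsPerfectPair I p q)
    {y : PathAlgebra k Q ⧸ I} (hy : pathIn I (QPath.triv p.source) * y = y)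
    (hpy : pathIn I p * y = 0) : ∃ z, y = pathIn I q * z := by
  refine exists_eq_pathIn_mul hI fun w hw => ?_
  obtain ⟨u, hu, e⟩ := h.right_unique w (isNonzeroPath_of_normalForm_ne_zero hI hw)
    (target_eq_of_triv_mul_eq hI hy hw) (pathIn_mul_eq_zero_of_mul_eq_zero' hI hpy hw)
  exact ⟨u, hu, e⟩

/-- The differential `x ↦ xp` of the complex attached to a sequence of perfect pairs. -/
noncomputable def perfectDifferential (s : ℤ → QPath Q)
    (hs : ∀ i, IsPerfectPair I (s i) (s (i + 1))) (i : ℤ) :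
    leftIdeal I (QPath.triv (s i).target) →ₗ[PathAlgebra k Q ⧸ I]
      leftIdeal I (QPath.triv (s (i + 1)).target) :=
  mulRightTo _ _ (pathIn I (s i)) (pathIn_mem_leftIdeal_triv (hs i).source_eq)

include hI in
theorem isTotallyAcyclic_perfectDifferential (s : ℤ → QPath Q)
    (hs : ∀ i, IsPerfectPair I (s i) (s (i + 1))) :
    IsTotallyAcyclic
      (fun i => ModuleCat.of (PathAlgebra k Q ⧸ I) (leftIdeal I (QPath.triv (s i).target)))
      (perfectDifferential s hs) where
  finite _ := finite_leftIdeal _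
  projective _ := projective_leftIdeal_triv _
  exact i := by
    intro x
    constructor
    · intro hx
      obtain ⟨a, ha⟩ := mem_leftIdeal_iff_exists.1
        ((hs i).mem_leftIdeal hI x.2 (congrArg Subtype.val hx))
      refine ⟨⟨a * pathIn I (QPath.triv (s i).target),
        Ideal.mul_mem_left _ _ (pathIn_mem_leftIdeal _)⟩, Subtype.ext ?_⟩
      rw [← ha]
      change a * pathIn I (QPath.triv (s i).target) * pathIn I (s i) = a * pathIn I (s i)
      rw [mul_assoc, triv_mul_pathIn]
    · rintro ⟨y, rfl⟩
      refine Subtype.ext ?_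
      change (y : PathAlgebra k Q ⧸ I) * pathIn I (s i) * pathIn I (s (i + 1)) = 0
      rw [mul_assoc, (hs i).mul_eq_zero, mul_zero]
  exact_dual i := by
    intro (g : leftIdeal I (QPath.triv (s (i + 1)).target) →ₗ[PathAlgebra k Q ⧸ I] _)
    constructor
    · intro hg
      set y := g ⟨pathIn I (QPath.triv (s (i + 1)).target), pathIn_mem_leftIdeal _⟩ with hy
      have hgy := apply_eq_mul_of_leftIdeal_triv g
      rw [← hy] at hgy
      have h1 : pathIn I (QPath.triv (s i).source) * y = y := by
        rw [(hs i).source_eq]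
        exact (hgy ⟨pathIn I (QPath.triv (s (i + 1)).target), pathIn_mem_leftIdeal _⟩).symm
      have h2 : pathIn I (s i) * y = 0 := by
        have e1 : perfectDifferential s hs i
            ⟨pathIn I (QPath.triv (s i).target), pathIn_mem_leftIdeal _⟩ =
            ⟨pathIn I (s i), pathIn_mem_leftIdeal_triv (hs i).source_eq⟩ :=
          Subtype.ext (triv_mul_pathIn (s i))
        have e2 : g (perfectDifferential s hs i
            ⟨pathIn I (QPath.triv (s i).target), pathIn_mem_leftIdeal _⟩) = 0 :=
          congrArg (· ⟨pathIn I (QPath.triv (s i).target), pathIn_mem_leftIdeal _⟩) hg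
        rw [e1, hgy] at e2
        exact e2
      obtain ⟨z, hz⟩ := (hs i).exists_eq_mul hI h1 h2
      refine ⟨LinearMap.toSpanSingleton _ _ z ∘ₗ
        (leftIdeal I (QPath.triv (s (i + 1 + 1)).target)).subtype, LinearMap.ext fun x => ?_⟩
      refine Eq.trans ?_ (hgy x).symm
      rw [hz, ← mul_assoc]
      rfl
    · rintro ⟨f, rfl⟩
      refine LinearMap.ext fun x => ?_
      change f (perfectDifferential s hs (i + 1) (perfectDifferential s hs i x)) = 0
      have : perfectDifferential s hs (i + 1) (perfectDifferential s hs i x) = 0 := by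
        refine Subtype.ext ?_
        change (x : PathAlgebra k Q ⧸ I) * pathIn I (s i) * pathIn I (s (i + 1)) = 0
        rw [mul_assoc, (hs i).mul_eq_zero, mul_zero]
      rw [this, map_zero]

include hI in
theorem nonempty_equiv_ker_perfectDifferential (s : ℤ → QPath Q)
    (hs : ∀ i, IsPerfectPair I (s i) (s (i + 1))) (i : ℤ) :
    Nonempty (leftIdeal I (s i) ≃ₗ[PathAlgebra k Q ⧸ I]
      LinearMap.ker (perfectDifferential s hs (i + 1))) := by
  have hle : leftIdeal I (s i) ≤ leftIdeal I (QPath.triv (s (i + 1)).target) := by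
    rw [← (hs i).source_eq]
    exact leftIdeal_le_leftIdeal_triv _
  refine ⟨LinearEquiv.ofBijective ((Submodule.inclusion hle).codRestrict _ fun x => ?_) ⟨?_, ?_⟩⟩
  · obtain ⟨a, ha⟩ := mem_leftIdeal_iff_exists.1 x.2
    refine Subtype.ext ?_
    change (x : PathAlgebra k Q ⧸ I) * pathIn I (s (i + 1)) = 0
    rw [← ha, mul_assoc, (hs i).mul_eq_zero, mul_zero]
  · intro x y hxy
    exact Subtype.ext (congrArg (fun z => z.1.1) hxy)
  · rintro ⟨x, hx⟩
    exact ⟨⟨x, (hs i).mem_leftIdeal hI x.2 (congrArg Subtype.val hx)⟩, rfl⟩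

/-- A perfect path is the member with index zero of a bi-infinite sequence of paths in which
neighbours form perfect pairs. -/
theorem IsPerfectPath.exists_sequence {p : QPath Q} (hp : IsPerfectPath I p) :
    ∃ s : ℤ → QPath Q, s 0 = p ∧ ∀ i, IsPerfectPair I (s i) (s (i + 1)) := by
  obtain ⟨-, n, s, hn, h1, hn1, hs⟩ := hp
  have hn' : (0 : ℤ) < n := by omega
  refine ⟨fun i => s ((i % n).toNat + 1), by simpa using h1, fun i => ?_⟩
  have hlt := Int.emod_lt_of_pos i hn'
  have hnn := Int.emod_nonneg i hn'.ne'
  have hpair := hs ((i % n).toNat + 1) (by omega) (by omega)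
  have e : s (((i + 1) % n).toNat + 1) = s ((i % n).toNat + 1 + 1) := by
    have hmod : (i + 1) % n = (i % n + 1) % n := by rw [Int.emod_add_emod]
    rw [hmod]
    by_cases hlast : i % n + 1 = n
    · rw [hlast, Int.emod_self]
      have : (i % n).toNat + 1 = n := by omega
      rw [this, hn1]
      exact h1
    · rw [Int.emod_eq_of_lt (by omega) (by omega)]
      congr 2
      omega
  change IsPerfectPair I _ (s (((i + 1) % n).toNat + 1))
  rw [e]
  exact hpair

theorem IsPerfectPath.exists_pair {p : QPath Q} (hp : IsPerfectPath I p) :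
    ∃ p', IsPerfectPair I p' p := by
  obtain ⟨-, n, s, hn, h1, hn1, hs⟩ := hp
  exact ⟨s n, hn1 ▸ hs n hn le_rfl⟩

include hI in
theorem IsPerfectPath.isGorensteinProjective {p : QPath Q} (hp : IsPerfectPath I p) :
    IsGorensteinProjective (PathAlgebra k Q ⧸ I) (leftIdeal I p) := by
  obtain ⟨s, rfl, hs⟩ := hp.exists_sequence
  exact isGorensteinProjective_iff.2 ⟨_, _, isTotallyAcyclic_perfectDifferential hI s hs, _,
    nonempty_equiv_ker_perfectDifferential hI s hs 0⟩

include hI in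
theorem IsPerfectPair.not_projective {p q : QPath Q} (h : IsPerfectPair I p q) :
    ¬ Module.Projective (PathAlgebra k Q ⧸ I) (leftIdeal I q) := fun hproj =>
  h.nonzero_left (eq_zero_of_mul_pathIn_eq_zero_of_projective hI h.nonzero_right hproj
    (pathIn_mem_leftIdeal_triv h.source_eq) h.mul_eq_zero)

/-! ### Perfect paths are determined by their modules -/

/-- A generator of `Aq` involves `q`. -/
theorem normalForm_ne_zero_of_mul_eq {q : QPath Q} (hq : IsNonzeroPath I q)
    {y c : PathAlgebra k Q ⧸ I} (hy : y ∈ leftIdeal I q) (hc : c * y = pathIn I q) :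
    normalForm hI y q ≠ 0 := by
  have h1 : normalForm hI (c * y) q ≠ 0 := by
    rw [hc, normalForm_pathIn_self hI hq]
    exact one_ne_zero
  obtain ⟨w, r, e, -, hr, hwr⟩ := exists_comp_of_normalForm_mul_ne_zero hI h1
  have h2 := (mem_leftIdeal_iff hI).1 hy r hr
  have h3 : q ∈ r.leftMultiples := ⟨w, e, hwr⟩
  rwa [QPath.leftMultiples_antisymm h3 h2]

include hI in
theorem mem_leftMultiples_of_equiv {p q p' q' : QPath Q} (hp : IsPerfectPair I p' p)
    (hq : IsPerfectPair I q' q)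
    (φ : leftIdeal I p ≃ₗ[PathAlgebra k Q ⧸ I] leftIdeal I q) : p' ∈ q'.leftMultiples := by
  set x : leftIdeal I p := ⟨pathIn I p, pathIn_mem_leftIdeal p⟩ with hx
  have hφ : ∀ a : PathAlgebra k Q ⧸ I, a * (φ x : PathAlgebra k Q ⧸ I) = φ (a • x) := by
    intro a
    rw [map_smul]
    rfl
  obtain ⟨c, hc⟩ := mem_leftIdeal_iff_exists.1
    (φ.symm ⟨pathIn I q, pathIn_mem_leftIdeal q⟩).2
  have hne : normalForm hI (φ x) q ≠ 0 := by
    refine normalForm_ne_zero_of_mul_eq hI hq.nonzero_right (φ x).2 (c := c) ?_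
    have e : c • x = φ.symm ⟨pathIn I q, pathIn_mem_leftIdeal q⟩ := Subtype.ext hc
    rw [hφ, e, LinearEquiv.apply_symm_apply]
  have ht : q.target = p.target := by
    refine target_eq_of_triv_mul_eq hI (x := φ x) ?_ hne
    rw [hφ]
    congr 2
    exact Subtype.ext (triv_mul_pathIn p)
  have hz : pathIn I p' * (φ x : PathAlgebra k Q ⧸ I) = 0 := by
    rw [hφ]
    have e : pathIn I p' • x = 0 := Subtype.ext hp.mul_eq_zero
    rw [e, map_zero]
    rfl
  obtain ⟨u, hu, e⟩ := hq.left_unique p' hp.nonzero_left (hp.source_eq.trans ht.symm)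
    (pathIn_mul_eq_zero_of_mul_eq_zero' hI hz hne)
  exact ⟨u, hu, e⟩

/-- The second member of a perfect pair is determined by the first one. -/
theorem IsPerfectPair.right_eq {p q q' : QPath Q} (h : IsPerfectPair I p q)
    (h' : IsPerfectPair I p q') : q = q' := by
  obtain ⟨u, hu, e⟩ := h.right_unique q' h'.nonzero_right h'.source_eq.symm h'.mul_eq_zero
  obtain ⟨u', hu', e'⟩ := h'.right_unique q h.nonzero_right h.source_eq.symm h.mul_eq_zero
  exact QPath.rightMultiples_antisymm ⟨u', hu', e'⟩ ⟨u, hu, e⟩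

include hI in
theorem IsPerfectPath.eq_of_equiv {p q : QPath Q} (hp : IsPerfectPath I p)
    (hq : IsPerfectPath I q) (φ : leftIdeal I p ≃ₗ[PathAlgebra k Q ⧸ I] leftIdeal I q) :
    p = q := by
  obtain ⟨p', hp'⟩ := hp.exists_pair
  obtain ⟨q', hq'⟩ := hq.exists_pair
  obtain rfl := QPath.leftMultiples_antisymm (mem_leftMultiples_of_equiv hI hp' hq' φ)
    (mem_leftMultiples_of_equiv hI hq' hp' φ.symm)
  exact hp'.right_eq hq'

end Modules

/-! ### Indecomposable Gorenstein-projective modules are generated by paths -/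

section Surjectivity

universe u

theorem IsGorensteinProjective.of_equiv {R : Type u} [Ring R] {M N : Type*} [AddCommGroup M]
    [Module R M] [AddCommGroup N] [Module R N] (e : N ≃ₗ[R] M) (h : IsGorensteinProjective R M) :
    IsGorensteinProjective R N := by
  obtain ⟨P, d, h1, h2, h3, i, ⟨e'⟩⟩ := h
  exact ⟨P, d, h1, h2, h3, i, ⟨e.trans e'⟩⟩

variable {k : Type*} [Field k] {Q : Type*} [Quiver Q] [Fintype Q]
  {I : Ideal (PathAlgebra k Q)} [I.IsTwoSided] (hI : IsMonomial I)

/-- A map out of `Ap` is determined by an element with at least as large an annihilator as `p`. -/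
theorem exists_linearMap_leftIdeal {N : Type*} [AddCommGroup N] [Module (PathAlgebra k Q ⧸ I) N]
    (p : QPath Q) (n : N) (h : ∀ a : PathAlgebra k Q ⧸ I, a * pathIn I p = 0 → a • n = 0) :
    ∃ σ : leftIdeal I p →ₗ[PathAlgebra k Q ⧸ I] N,
      ∀ (a : PathAlgebra k Q ⧸ I) (x : leftIdeal I p), (x : PathAlgebra k Q ⧸ I) = a * pathIn I p →
        σ x = a • n := by
  have hex : ∀ x : leftIdeal I p, ∃ a, (x : PathAlgebra k Q ⧸ I) = a * pathIn I p := fun x =>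
    (mem_leftIdeal_iff_exists.1 x.2).imp fun _ h => h.symm
  choose c hc using hex
  have key : ∀ (a : PathAlgebra k Q ⧸ I) (x : leftIdeal I p),
      (x : PathAlgebra k Q ⧸ I) = a * pathIn I p → c x • n = a • n := by
    intro a x hx
    rw [← sub_eq_zero, ← sub_smul]
    apply h
    rw [sub_mul, ← hx, ← hc, sub_self]
  refine ⟨{ toFun := fun x => c x • n, map_add' := fun x y => ?_, map_smul' := fun b x => ?_ }, key⟩
  · rw [← add_smul]
    apply key
    rw [add_mul, ← hc, ← hc]
    rfl
  · rw [RingHom.id_apply, smul_smul]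
    apply key
    rw [mul_assoc, ← hc]
    rfl

/-- An indecomposable Gorenstein-projective module `M` is isomorphic to `Ap`, where `p` is a path
of minimal length among all paths occurring in the values of functionals on `M`. -/
theorem IsGorensteinProjective.exists_equiv_leftIdeal {M : Type*} [AddCommGroup M]
    [Module (PathAlgebra k Q ⧸ I) M] (hM : IsGorensteinProjective (PathAlgebra k Q ⧸ I) M)
    (hind : IsIndecomposable (PathAlgebra k Q ⧸ I) M) :
    ∃ p : QPath Q, IsNonzeroPath I p ∧ Nonempty (M ≃ₗ[PathAlgebra k Q ⧸ I] leftIdeal I p) ∧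
      ∀ (g : M →ₗ[PathAlgebra k Q ⧸ I] PathAlgebra k Q ⧸ I) (m : M) (w : QPath Q),
        normalForm hI (g m) w ≠ 0 → p.length ≤ w.length := by
  classical
  have hex : ∃ n, ∃ (g : M →ₗ[PathAlgebra k Q ⧸ I] PathAlgebra k Q ⧸ I) (m : M) (w : QPath Q),
      normalForm hI (g m) w ≠ 0 ∧ w.length = n := by
    obtain ⟨m, hm⟩ := @exists_ne M hind.1 0
    obtain ⟨g, hg⟩ := hM.exists_dual_ne_zero hm
    obtain ⟨w, hw⟩ := exists_normalForm_ne_zero hI hg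
    exact ⟨_, g, m, w, hw, rfl⟩
  obtain ⟨g₀, m₀, p, hp, hlen⟩ := Nat.find_spec hex
  have hmin : ∀ (g : M →ₗ[PathAlgebra k Q ⧸ I] PathAlgebra k Q ⧸ I) (m : M) (w : QPath Q),
      normalForm hI (g m) w ≠ 0 → p.length ≤ w.length := by
    intro g m w hw
    rw [hlen]
    exact Nat.find_min' hex ⟨g, m, w, hw, rfl⟩
  have hpn := isNonzeroPath_of_normalForm_ne_zero hI hp
  -- the part in `Ap` of the functional `g₀`
  let f : M →ₗ[PathAlgebra k Q ⧸ I] leftIdeal I p :=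
    { toFun := fun m => ⟨part hI p.leftMultiples (g₀ m), (mem_leftIdeal_iff hI).2 fun w hw =>
        (mem_of_normalForm_part_ne_zero hI hw).1⟩
      map_add' := fun m m' => Subtype.ext (by
        change part hI _ (g₀ (m + m')) = part hI _ (g₀ m) + part hI _ (g₀ m')
        rw [map_add, map_add])
      map_smul' := fun a m => Subtype.ext (by
        change part hI _ (g₀ (a • m)) = a * part hI _ (g₀ m)
        rw [map_smul, smul_eq_mul, part_leftMultiples_mul hI a (hmin g₀ m)]) }
  have hf₀ : normalForm hI (f m₀) p ≠ 0 := by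
    change normalForm hI (part hI p.leftMultiples (g₀ m₀)) p ≠ 0
    rwa [normalForm_part, if_pos p.self_mem_leftMultiples]
  obtain ⟨c, hc⟩ := exists_unit_mul_eq hI (f m₀).2 hf₀
  set m₁ := (c : PathAlgebra k Q ⧸ I) • m₀ with hm₁
  have hf₁ : (f m₁ : PathAlgebra k Q ⧸ I) = pathIn I p := by
    rw [hm₁, map_smul]
    exact hc
  -- the part in `pA` of the evaluation at `m₁` is again an evaluation
  obtain ⟨m, hm⟩ := hM.exists_eval
    { toFun := fun g => part hI p.rightMultiples (g m₁)
      map_zero' := by simp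
      map_add' := fun g g' => by simp } (fun g y => by
        change part hI p.rightMultiples (g m₁ * y) = part hI p.rightMultiples (g m₁) * y
        exact part_rightMultiples_mul hI y (hmin g m₁))
  have hfm : (f m : PathAlgebra k Q ⧸ I) = pathIn I p := by
    have h1 := hm ((leftIdeal I p).subtype ∘ₗ f)
    change (f m : PathAlgebra k Q ⧸ I) = part hI p.rightMultiples (f m₁) at h1
    rwa [hf₁, part_pathIn_of_mem hI p.self_mem_rightMultiples] at h1
  obtain ⟨σ, hσ⟩ := exists_linearMap_leftIdeal p m (by
    intro a ha
    by_contra hne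
    obtain ⟨g, hg⟩ := hM.exists_dual_ne_zero hne
    apply hg
    have h1 : g m = part hI p.rightMultiples (g m₁) := hm g
    obtain ⟨z, hz⟩ := exists_eq_pathIn_mul hI (x := part hI p.rightMultiples (g m₁))
      (p := p) fun w hw => (mem_of_normalForm_part_ne_zero hI hw).1
    rw [map_smul, h1, hz, smul_eq_mul, ← mul_assoc, ha, zero_mul])
  have hfσ : ∀ x, f (σ x) = x := by
    intro x
    obtain ⟨a, ha⟩ := mem_leftIdeal_iff_exists.1 x.2
    rw [hσ a x ha.symm, map_smul]
    refine Subtype.ext ?_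
    change a * (f m : PathAlgebra k Q ⧸ I) = x
    rw [hfm, ha]
  refine ⟨p, hpn, ⟨LinearEquiv.ofBijective f ⟨?_, fun x => ⟨σ x, hfσ x⟩⟩⟩, hmin⟩
  rcases hind.2 _ _ (isCompl_range_ker_of_leftInverse hfσ) with h | h
  · have h0 := hfσ ⟨pathIn I p, pathIn_mem_leftIdeal p⟩
    rw [LinearMap.range_eq_bot.1 h, LinearMap.zero_apply, map_zero] at h0
    exact absurd (congrArg Subtype.val h0).symm hpn
  · exact LinearMap.ker_eq_bot.1 h

/-! ### Perfectness from total acyclicity -/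

variable (I) in
/-- The left annihilator of the path `p` in `Ae`, where `e` is the trivial path at `t(p)`, is the
left ideal generated by the nonzero path `q`. -/
structure IsLeftAnnihilator (q p : QPath Q) : Prop where
  nonzero_left : IsNonzeroPath I q
  nonzero_right : IsNonzeroPath I p
  source_eq : q.source = p.target
  mul_eq_zero : pathIn I q * pathIn I p = 0
  mem_leftIdeal : ∀ x ∈ leftIdeal I (QPath.triv p.target), x * pathIn I p = 0 → x ∈ leftIdeal I q

variable (I) in
/-- Each functional on `Aq` is given by right multiplication by an element of `A`, or equivalently,
extends to `A`. -/
def FunctionalsExtend (q : QPath Q) : Prop :=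
  ∀ h : leftIdeal I q →ₗ[PathAlgebra k Q ⧸ I] PathAlgebra k Q ⧸ I,
    ∃ y : PathAlgebra k Q ⧸ I, ∀ x, h x = x * y

namespace IsLeftAnnihilator

variable {q p : QPath Q} (h : IsLeftAnnihilator I q p)

include h

theorem one_le_length : 1 ≤ q.length := by
  by_contra! hlt
  have hq : q = QPath.triv p.target := by
    rw [← h.source_eq]
    exact QPath.eq_triv_of_length_eq_zero q (by omega)
  have := h.mul_eq_zero
  rw [hq, triv_mul_pathIn] at this
  exact h.nonzero_right this

theorem exists_mul_eq {a : PathAlgebra k Q ⧸ I} (ha : a * pathIn I p = 0) :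
    ∃ b, a * pathIn I (QPath.triv p.target) = b * pathIn I q := by
  obtain ⟨b, hb⟩ := mem_leftIdeal_iff_exists.1 (h.mem_leftIdeal
    (a * pathIn I (QPath.triv p.target)) (Ideal.mul_mem_left _ _ (pathIn_mem_leftIdeal _))
    (by rw [mul_assoc, triv_mul_pathIn, ha]))
  exact ⟨b, hb.symm⟩

/-- A path `y` with `qy = 0` is the image of `p` under a functional on `Ap`. -/
theorem exists_functional {y : QPath Q} (hy : y.target = p.target)
    (hqy : pathIn I q * pathIn I y = 0) :
    ∃ g : leftIdeal I p →ₗ[PathAlgebra k Q ⧸ I] PathAlgebra k Q ⧸ I,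
      g ⟨pathIn I p, pathIn_mem_leftIdeal p⟩ = pathIn I y := by
  obtain ⟨σ, hσ⟩ := exists_linearMap_leftIdeal p (pathIn I y) (by
    intro a ha
    obtain ⟨b, hb⟩ := h.exists_mul_eq ha
    rw [smul_eq_mul, ← triv_mul_pathIn y, hy, ← mul_assoc, hb, mul_assoc, hqy, mul_zero])
  refine ⟨σ, ?_⟩
  have := hσ 1 ⟨pathIn I p, pathIn_mem_leftIdeal p⟩ (one_mul _).symm
  rwa [one_smul] at this

include hI in
theorem isPerfectPair (hp : 1 ≤ p.length)
    (hr : ∀ y : QPath Q, IsNonzeroPath I y → y.target = p.target →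
      pathIn I q * pathIn I y = 0 → y ∈ p.rightMultiples) : IsPerfectPair I q p where
  nonzero_left := h.nonzero_left
  nonzero_right := h.nonzero_right
  nontrivial_left := h.one_le_length
  nontrivial_right := hp
  source_eq := h.source_eq
  mul_eq_zero := h.mul_eq_zero
  right_unique y hy ht hqy := by
    obtain ⟨u, hu, e⟩ := hr y hy (ht.trans h.source_eq) hqy
    exact ⟨u, hu, e⟩
  left_unique x hx hs hxp := by
    have hmem := h.mem_leftIdeal _ (pathIn_mem_leftIdeal_triv hs) hxp
    obtain ⟨u, hu, e⟩ := (mem_leftIdeal_iff hI).1 hmem x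
      (by rw [normalForm_pathIn_self hI hx]; exact one_ne_zero)
    exact ⟨u, hu, e⟩

theorem exact_inclusion : Function.Exact
    (Submodule.inclusion ((leftIdeal_le_leftIdeal_triv q).trans_eq (by rw [h.source_eq])) :
      leftIdeal I q →ₗ[PathAlgebra k Q ⧸ I] leftIdeal I (QPath.triv p.target))
    (mulRightTo (leftIdeal I (QPath.triv p.target)) (leftIdeal I p) (pathIn I p)
      (pathIn_mem_leftIdeal p)) := by
  intro x
  constructor
  · intro hx
    exact ⟨⟨x, h.mem_leftIdeal x x.2 (congrArg Subtype.val hx)⟩, rfl⟩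
  · rintro ⟨y, rfl⟩
    obtain ⟨a, ha⟩ := mem_leftIdeal_iff_exists.1 y.2
    refine Subtype.ext ?_
    change (y : PathAlgebra k Q ⧸ I) * pathIn I p = 0
    rw [← ha, mul_assoc, h.mul_eq_zero, mul_zero]

end IsLeftAnnihilator

include hI in
/-- Let `Ap` be a stable retract of a module of cocycles of a totally acyclic complex. If the left
annihilator of `p` in `Ae` is nonzero, then it is generated by a shortest path `q` in it: the
functional taking the part in `Aq` extends to `Ae`, which forces all paths in the annihilator to be
left multiples of `q`. -/
theorem exists_isLeftAnnihilator {P : ℤ → ModuleCat (PathAlgebra k Q ⧸ I)}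
    {d : ∀ i : ℤ, P i →ₗ[PathAlgebra k Q ⧸ I] P (i + 1)} (hd : IsTotallyAcyclic P d)
    {p : QPath Q} (hp : IsNonzeroPath I p)
    (hX : ∃ j, IsStableRetract (R := PathAlgebra k Q ⧸ I) (LinearMap.ker (d j)) (leftIdeal I p))
    (hne : ∃ x ∈ leftIdeal I (QPath.triv p.target), x * pathIn I p = 0 ∧ x ≠ 0) :
    ∃ q, IsLeftAnnihilator I q p ∧ FunctionalsExtend I q ∧
      ∃ j, IsStableRetract (R := PathAlgebra k Q ⧸ I) (LinearMap.ker (d j)) (leftIdeal I q) := by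
  classical
  have hex : ∃ n, ∃ w : QPath Q, IsNonzeroPath I w ∧ w.source = p.target ∧
      pathIn I w * pathIn I p = 0 ∧ w.length = n := by
    obtain ⟨x, hx, hxp, hx0⟩ := hne
    obtain ⟨w, hw⟩ := exists_normalForm_ne_zero hI hx0
    exact ⟨_, w, isNonzeroPath_of_normalForm_ne_zero hI hw,
      source_eq_of_mem_leftIdeal_triv hI hx hw, pathIn_mul_eq_zero_of_mul_eq_zero hI hxp hw, rfl⟩
  obtain ⟨q, hq, hqs, hqp, hlen⟩ := Nat.find_spec hex
  set ε := mulRightTo (leftIdeal I (QPath.triv p.target)) (leftIdeal I p) (pathIn I p)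
    (pathIn_mem_leftIdeal p) with hε
  have hεs : Function.Surjective ε := mulRightTo_triv_surjective p
  have hmin : ∀ (x : LinearMap.ker ε) (w : QPath Q),
      normalForm hI ((x : leftIdeal I (QPath.triv p.target)) : PathAlgebra k Q ⧸ I) w ≠ 0 →
        q.length ≤ w.length := by
    intro x w hw
    rw [hlen]
    exact Nat.find_min' hex ⟨w, isNonzeroPath_of_normalForm_ne_zero hI hw,
      source_eq_of_mem_leftIdeal_triv hI x.1.2 hw,
      pathIn_mul_eq_zero_of_mul_eq_zero hI (congrArg Subtype.val x.2) hw, rfl⟩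
  let h : LinearMap.ker ε →ₗ[PathAlgebra k Q ⧸ I] PathAlgebra k Q ⧸ I :=
    { toFun := fun x => part hI q.leftMultiples x.1.1
      map_add' := fun x y => map_add _ _ _
      map_smul' := fun a x => part_leftMultiples_mul hI a (hmin x) }
  obtain ⟨g, hg⟩ := (hd.extension_and_syzygy (projective_leftIdeal_triv _)
    (Submodule.subtype_injective _) ε.exact_subtype_ker_map hεs hX).1 h
  set y := g ⟨pathIn I (QPath.triv p.target), pathIn_mem_leftIdeal _⟩ with hy
  have hgy : ∀ (x : PathAlgebra k Q ⧸ I) (_ : x ∈ leftIdeal I (QPath.triv p.target))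
      (_ : x * pathIn I p = 0), part hI q.leftMultiples x = x * y := by
    intro x hx hxp
    have h1 := hg ⟨⟨x, hx⟩, Subtype.ext hxp⟩
    rw [apply_eq_mul_of_leftIdeal_triv] at h1
    exact h1.symm
  have hy1 : normalForm hI y (QPath.triv p.target) = 1 := by
    have h1 := hgy _ (pathIn_mem_leftIdeal_triv hqs) hqp
    rw [part_pathIn_of_mem hI q.self_mem_leftMultiples] at h1
    rw [← hqs, ← normalForm_pathIn_mul_self hI y hq, ← h1, normalForm_pathIn_self hI hq]
  have hann : IsLeftAnnihilator I q p :=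
    { nonzero_left := hq
      nonzero_right := hp
      source_eq := hqs
      mul_eq_zero := hqp
      mem_leftIdeal := by
        intro x hx hxp
        rw [mem_leftIdeal_iff hI]
        intro w hw
        have hwn := isNonzeroPath_of_normalForm_ne_zero hI hw
        have hws := source_eq_of_mem_leftIdeal_triv hI hx hw
        by_contra hmem
        have h1 := hgy _ (pathIn_mem_leftIdeal_triv hws)
          (pathIn_mul_eq_zero_of_mul_eq_zero hI hxp hw)
        rw [part_pathIn_of_notMem hI hmem] at h1
        have h2 := normalForm_pathIn_mul_self hI y hwn
        rw [← h1, hws, hy1, map_zero] at h2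
        exact zero_ne_one h2 }
  obtain ⟨hext, hst⟩ := hd.extension_and_syzygy (projective_leftIdeal_triv _)
    (Submodule.inclusion_injective _) hann.exact_inclusion (mulRightTo_triv_surjective p) hX
  refine ⟨q, hann, fun h => ?_, hst⟩
  obtain ⟨g, hg⟩ := hext h
  refine ⟨g ⟨pathIn I (QPath.triv p.target), pathIn_mem_leftIdeal _⟩, fun x => ?_⟩
  rw [← hg, apply_eq_mul_of_leftIdeal_triv]
  rfl

include hI in
/-- If all functionals on `Aq` are right multiplications, then the left annihilator of `q` is
nonzero. -/
theorem FunctionalsExtend.exists_mul_eq_zero {q : QPath Q} (hext : FunctionalsExtend I q)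
    (hq : IsNonzeroPath I q) (hlen : 1 ≤ q.length) :
    ∃ x ∈ leftIdeal I (QPath.triv q.target), x * pathIn I q = 0 ∧ x ≠ 0 := by
  by_contra! hcon
  -- otherwise there is a functional mapping `q` to the trivial path at `t(q)`
  obtain ⟨σ, hσ⟩ := exists_linearMap_leftIdeal q
    (pathIn I (QPath.triv q.target)) (by
      intro a ha
      exact hcon _ (Ideal.mul_mem_left _ _ (pathIn_mem_leftIdeal _))
        (by rw [smul_eq_mul, mul_assoc, triv_mul_pathIn, ha]))
  obtain ⟨y, hy⟩ := hext σ
  have h1 := hσ 1 ⟨pathIn I q, pathIn_mem_leftIdeal q⟩ (one_mul _).symm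
  have h2 : pathIn I q * y = pathIn I (QPath.triv q.target) := by
    rw [hy, one_smul] at h1
    exact h1
  have h3 : normalForm hI (pathIn I q * y) (QPath.triv q.target) ≠ 0 := by
    rw [h2, normalForm_pathIn_self hI hq.triv_target]
    exact one_ne_zero
  obtain ⟨w, r, e, hw, -, hwr⟩ := exists_comp_of_normalForm_mul_ne_zero hI h3
  have hw' := eq_of_normalForm_pathIn_ne_zero hI hw
  have h4 := congrArg QPath.length hwr
  rw [QPath.length_comp, hw', QPath.length_triv] at h4
  omega

include hI in
theorem FunctionalsExtend.isPerfectPair {q q' : QPath Q} (hext : FunctionalsExtend I q)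
    (hlen : 1 ≤ q.length) (h : IsLeftAnnihilator I q' q) : IsPerfectPair I q' q := by
  refine h.isPerfectPair hI hlen fun y hy ht hqy => ?_
  obtain ⟨g, hg⟩ := h.exists_functional ht hqy
  obtain ⟨z, hz⟩ := hext g
  rw [hz] at hg
  have h1 : normalForm hI (pathIn I q * z) y ≠ 0 := by
    have h2 : pathIn I q * z = pathIn I y := hg
    rw [h2, normalForm_pathIn_self hI hy]
    exact one_ne_zero
  obtain ⟨w, r, e, hw, -, rfl⟩ := exists_comp_of_normalForm_mul_ne_zero hI h1
  obtain rfl := eq_of_normalForm_pathIn_ne_zero hI hw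
  exact ⟨r, e, rfl⟩

/-- If `Ap` is Gorenstein-projective and `p` is a shortest path occurring in the values of
functionals on `Ap`, then `p` forms a perfect pair with the generator of its left annihilator:
by reflexivity, taking the part in `pA` of the values at `p` is evaluation at some `ap`. -/
theorem IsLeftAnnihilator.isPerfectPair_of_reflexive {q p : QPath Q}
    (h : IsLeftAnnihilator I q p) (hlen : 1 ≤ p.length)
    (hG : IsGorensteinProjective (PathAlgebra k Q ⧸ I) (leftIdeal I p))
    (hmin : ∀ (g : leftIdeal I p →ₗ[PathAlgebra k Q ⧸ I] PathAlgebra k Q ⧸ I)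
      (x : leftIdeal I p) (w : QPath Q), normalForm hI (g x) w ≠ 0 → p.length ≤ w.length) :
    IsPerfectPair I q p := by
  refine h.isPerfectPair hI hlen fun y hy ht hqy => ?_
  set x₀ : leftIdeal I p := ⟨pathIn I p, pathIn_mem_leftIdeal p⟩ with hx₀
  obtain ⟨m, hm⟩ := hG.exists_eval
    { toFun := fun g => part hI p.rightMultiples (g x₀)
      map_zero' := by simp
      map_add' := fun g g' => by simp } (fun g y => by
        change part hI p.rightMultiples (g x₀ * y) = part hI p.rightMultiples (g x₀) * y
        exact part_rightMultiples_mul hI y (hmin g x₀))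
  obtain ⟨a, ha⟩ := mem_leftIdeal_iff_exists.1 m.2
  have hmx : m = a • x₀ := Subtype.ext ha.symm
  have key : ∀ g : leftIdeal I p →ₗ[PathAlgebra k Q ⧸ I] PathAlgebra k Q ⧸ I,
      a * g x₀ = part hI p.rightMultiples (g x₀) := by
    intro g
    rw [← smul_eq_mul, ← map_smul, ← hmx]
    exact hm g
  have ha1 : normalForm hI a (QPath.triv p.target) = 1 := by
    have h1 : a * pathIn I p = part hI p.rightMultiples (pathIn I p) :=
      key (leftIdeal I p).subtype
    rw [part_pathIn_of_mem hI p.self_mem_rightMultiples] at h1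
    rw [← normalForm_mul_pathIn_self hI a h.nonzero_right, h1,
      normalForm_pathIn_self hI h.nonzero_right]
  obtain ⟨g, hg⟩ := h.exists_functional ht hqy
  by_contra hmem
  have h2 := key g
  rw [hg, part_pathIn_of_notMem hI hmem] at h2
  have h3 := normalForm_mul_pathIn_self hI a hy
  rw [h2, ht, ha1, map_zero] at h3
  exact zero_ne_one h3

include hI in
/-- A sequence of paths in which `(c (n + 1), c n)` is always a perfect pair starts with a perfect
path: there are only finitely many nonzero paths, so that the sequence has a repetition, and the
second member of a perfect pair is determined by the first one. -/
theorem isPerfectPath_of_sequence [∀ a b : Q, Finite (a ⟶ b)] (c : ℕ → QPath Q)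
    (hc : ∀ n, IsPerfectPair I (c (n + 1)) (c n)) : IsPerfectPath I (c 0) := by
  obtain ⟨a, b, hab, heq⟩ := (finite_isNonzeroPath hI).exists_lt_map_eq_of_forall_mem
    (f := c) fun n => (hc n).nonzero_right
  have hback : ∀ i, i ≤ a → c (a - i) = c (b - i) := by
    intro i
    induction i with
    | zero => exact fun _ => heq
    | succ i ih =>
      intro hi
      have h1 := hc (a - (i + 1))
      have h2 := hc (b - (i + 1))
      rw [show a - (i + 1) + 1 = a - i by omega, ih (by omega)] at h1
      rw [show b - (i + 1) + 1 = b - i by omega] at h2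
      exact h1.right_eq h2
  have h0 := hback a le_rfl
  rw [Nat.sub_self] at h0
  refine ⟨(hc 0).nonzero_right, b - a, fun i => c (b - a + 1 - i), by omega, ?_, ?_, ?_⟩
  · simp [h0]
  · simp
  · intro i hi hi'
    have h1 := hc (b - a - i)
    rw [show b - a - i + 1 = b - a + 1 - i by omega] at h1
    change IsPerfectPair I (c (b - a + 1 - i)) (c (b - a + 1 - (i + 1)))
    rwa [show b - a + 1 - (i + 1) = b - a - i by omega]

/-- Every indecomposable non-projective Gorenstein-projective module is isomorphic to `Ap` for a
perfect path `p`. -/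
theorem IsGorensteinProjective.exists_isPerfectPath [∀ a b : Q, Finite (a ⟶ b)]
    (hI : IsMonomial I) {M : Type*} [AddCommGroup M]
    [Module (PathAlgebra k Q ⧸ I) M] (hM : IsGorensteinProjective (PathAlgebra k Q ⧸ I) M)
    (hind : IsIndecomposable (PathAlgebra k Q ⧸ I) M)
    (hproj : ¬ Module.Projective (PathAlgebra k Q ⧸ I) M) :
    ∃ p : QPath Q, IsPerfectPath I p ∧
      Nonempty (M ≃ₗ[PathAlgebra k Q ⧸ I] leftIdeal I p) := by
  obtain ⟨p, hp, ⟨e⟩, hmin⟩ := hM.exists_equiv_leftIdeal hI hind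
  have hproj' : ¬ Module.Projective (PathAlgebra k Q ⧸ I) (leftIdeal I p) := fun h =>
    hproj (Module.Projective.of_equiv e.symm)
  have hlen : 1 ≤ p.length := by
    by_contra! hlt
    apply hproj'
    rw [QPath.eq_triv_of_length_eq_zero p (by omega)]
    infer_instance
  have hann : ∃ x ∈ leftIdeal I (QPath.triv p.target), x * pathIn I p = 0 ∧ x ≠ 0 := by
    by_contra! hcon
    refine hproj' (Module.Projective.of_equiv (LinearEquiv.ofBijective _
      ⟨(injective_iff_map_eq_zero _).2 fun x hx => ?_, mulRightTo_triv_surjective p⟩))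
    exact Subtype.ext (hcon x x.2 (congrArg Subtype.val hx))
  have hG := hM.of_equiv e.symm
  obtain ⟨P, d, hd, j, ⟨e'⟩⟩ := isGorensteinProjective_iff.1 hG
  obtain ⟨q, hqp, hext, hst⟩ := exists_isLeftAnnihilator hI hd hp
    ⟨j, IsStableRetract.of_equiv e'⟩ hann
  have hpair : IsPerfectPair I q p := hqp.isPerfectPair_of_reflexive hI hlen hG
    fun g x w hw => hmin (g ∘ₗ e.toLinearMap) (e.symm x) w (by simpa using hw)
  -- the annihilators of `p`, of their generators, and so on
  let Good : QPath Q → Prop := fun q => IsNonzeroPath I q ∧ 1 ≤ q.length ∧ FunctionalsExtend I q ∧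
    ∃ j, IsStableRetract (R := PathAlgebra k Q ⧸ I) (LinearMap.ker (d j)) (leftIdeal I q)
  have hstep : ∀ q : {q // Good q}, ∃ q' : {q // Good q}, IsPerfectPair I q'.1 q.1 := by
    rintro ⟨q, hq, hqlen, hqext, hqst⟩
    obtain ⟨q', hq', hext', hst'⟩ := exists_isLeftAnnihilator hI hd hq hqst
      (hqext.exists_mul_eq_zero hI hq hqlen)
    exact ⟨⟨q', hq'.nonzero_left, hq'.one_le_length, hext', hst'⟩,
      hqext.isPerfectPair hI hqlen hq'⟩
  choose f hf using hstep
  let q₀ : {q // Good q} := ⟨q, hpair.nonzero_left, hpair.nontrivial_left, hext, hst⟩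
  let c : ℕ → QPath Q := fun n => Nat.casesOn n p fun n => (f^[n] q₀).1
  refine ⟨p, isPerfectPath_of_sequence hI c fun n => ?_, ⟨e⟩⟩
  cases n with
  | zero => exact hpair
  | succ n =>
    change IsPerfectPair I (f^[n + 1] q₀).1 (f^[n] q₀).1
    rw [Function.iterate_succ_apply']
    exact hf _

end Surjectivity

end MonomialGorenstein

open MonomialGorenstein in
theorem theorem4p1 (k : Type*) [Field k] (Q : Type*) [Quiver Q] [Fintype Q]
    [∀ a b : Q, Finite (a ⟶ b)] (I : Ideal (PathAlgebra k Q)) [I.IsTwoSided]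
    (hI : IsMonomial I) :
    Set.BijOn (fun p : QPath Q => isoclass (PathAlgebra k Q ⧸ I) (leftIdeal I p))
      {p : QPath Q | IsPerfectPath I p} (indecGProj (PathAlgebra k Q ⧸ I)) := by
  refine ⟨fun p hp => ?_, fun p hp q hq hpq => ?_, ?_⟩
  · obtain ⟨p', hp'⟩ := hp.exists_pair
    exact ⟨ModuleCat.of _ (leftIdeal I p), rfl, finite_leftIdeal p, isIndecomposable_leftIdeal hI hp.1,
      hp'.not_projective hI, hp.isGorensteinProjective hI⟩
  · obtain ⟨e⟩ := Quotient.exact hpq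
    exact hp.eq_of_equiv hI hq e.toLinearEquiv
  · rintro _ ⟨M, rfl, -, hind, hproj, hG⟩
    obtain ⟨p, hp, ⟨e⟩⟩ := hG.exists_isPerfectPath hI hind hproj
    exact ⟨p, hp, Quotient.sound ⟨e.symm.toModuleIso⟩⟩
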